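/- For $p,q\ge 0$ let $\mathbb{R}^{p,q}$ be $\mathbb{R}^{p+q}$ with the form $\langle\langle x,y\rangle\rangle=\sum_{i\le p}x_iy_i-\sum_{i>p}x_iy_i$. A representation of a simple graph $G=(V,E)$ in $\mathbb{R}^{p,q}$ with distances $a,b\in\mathbb{R}$ is a (not necessarily injective) map $\varphi:V\to\mathbb{R}^{p,q}$ such that $\langle\langle \varphi(u)-\varphi(v),\varphi(u)-\varphi(v)\rangle\rangle$ equals $a$ if $u,v$ are adjacent and $b$ if $u\neq v$ are not adjacent. For $U\subset V$, switching $G$ with respect to $U$ reverses adjacency between $U$ and $V\setminus U$ and keeps it elsewhere; the switching class of $G$ is the set of all graphs so obtained. Its minimum dimensionality $d$ is the least $p+q$ for which some graph in the class has a representation in $\mathbb{R}^{p,q}$ with distances $a\ne b$. A Delsarte clique of a $k$-regular graph with smallest adjacency eigenvalue $\lambda$ is a clique of size $1-k/\lambda$. The Johnson graph $J(m,2)$ has as vertices the $2$-element subsets of an $m$-element set, two being adjacent if they meet in exactly one element. Theorem. Let $m\ge 4$ and $(V,E)=J(m,2)$. The minimum dimensionality $d$ of the switching class of $(V,E)$ is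 given below, together with all $U\subset V$ with $|U|\le |V|/2$, all $a\neq b$ and all $(p,q)$ with $p+q=d$ such that the graph obtained by switching with respect to $U$ has a representation in $\mathbb{R}^{p,q}$ with distances $a,b$. Here $(a,b)$ is listed up to multiplication by a non-zero real number $c$, where for $c<0$ the listed pair $(p,q)$ is replaced by $(q,p)$. 1. For $m=4$: $d=2$, and exactly the following occur: $(p,q)=(2,0)$, $U=\emptyset$, $(a,b)=(1,0)$; or $(p,q)=(1,1)$, $U$ is a set of two non-adjacent vertices, $(a,b)=(1,0)$. In the first case the image of every such representation is the vertex set of a regular triangle. 2. For $m=5$: $d=4$, and exactly the following occur, with $(p,q)=(4,0)$: $U$ is empty or a Delsarte clique, and $(a,b)=(1,2)$; or the graph induced by $(V,E)$ on $U$ is a $5$-cycle, and $(a,b)=(2,1)$. 3. For $m=6,7,9$: $d=m-1$, and exactly the following occur: $(p,q)=(m-1,0)$, $U$ is empty or a Delsarte clique, $(a,b)=(1,2)$. 4. For $m=8$: $d=7$, and exactly the following occur: $(p,q)=(7,0)$, $U$ is arbitrary, $(a,b)=(1,2)$. 5. For $m=10$: $d=8$, and exactly the following occur: $(p,q)=(8,0)$,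 $U$ is a Delsarte clique, $(a,b)=(1,2)$. 6. For $m\ge 11$: $d=m-1$, and exactly the following occur: $(p,q)=(m-1,0)$, $U=\emptyset$, $(a,b)=(1,2)$; or $(p,q)=(m-2,1)$, $U$ is a Delsarte clique, $(a,b)=(1,2)$. -/

import Mathlib

/-- The pseudo-Euclidean space `ℝ^{p,q}`: the first `p` coordinates are the positive directions,
the last `q` coordinates the negative ones. -/
abbrev PseudoEuclidean (p q : ℕ) : Type := Fin p ⊕ Fin q → ℝ

/-- The indefinite bilinear form `x₁y₁ + ⋯ + x_p y_p - x_{p+1}y_{p+1} - ⋯ - x_{p+q}y_{p+q}`. -/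
def pseudoInner {p q : ℕ} (x y : PseudoEuclidean p q) : ℝ :=
  ∑ i : Fin p, x (Sum.inl i) * y (Sum.inl i) - ∑ j : Fin q, x (Sum.inr j) * y (Sum.inr j)

/-- The scalar square `⟪x, x⟫`. -/
def scalarSq {p q : ℕ} (x : PseudoEuclidean p q) : ℝ := pseudoInner x x

/-- `φ` is a representation of `G` in `ℝ^{p,q}` with distances `a` (adjacent vertices) and
`b` (distinct non-adjacent vertices). It need not be injective. The scalar square of
`φ u - φ u` is always `0`. -/
def IsRepresentation {V : Type*} (G : SimpleGraph V) (a b : ℝ) {p q : ℕ}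
    (φ : V → PseudoEuclidean p q) : Prop :=
  (∀ u v, G.Adj u v → scalarSq (φ u - φ v) = a) ∧
  (∀ u v, u ≠ v → ¬ G.Adj u v → scalarSq (φ u - φ v) = b)

/-- `G` has a representation in `ℝ^{p,q}` with distances `a` and `b`. -/
def IsRepresentable {V : Type*} (G : SimpleGraph V) (a b : ℝ) (p q : ℕ) : Prop :=
  ∃ φ : V → PseudoEuclidean p q, IsRepresentation G a b φ

/-- Seidel switching of `G` with respect to `U`: adjacency is kept inside `U` and inside its
complement, and reversed between the two. -/
def seidelSwitch {V : Type*} (G : SimpleGraph V) (U : Finset V) : SimpleGraph V where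
  Adj u v := ((u ∈ U ↔ v ∈ U) ∧ G.Adj u v) ∨ (¬ (u ∈ U ↔ v ∈ U) ∧ ¬ G.Adj u v)
  symm := ⟨by
    intro u v h
    rcases h with ⟨h, h'⟩ | ⟨h, h'⟩
    · exact Or.inl ⟨h.symm, h'.symm⟩
    · exact Or.inr ⟨fun k => h k.symm, fun k => h' k.symm⟩⟩
  loopless := ⟨by
    intro u h
    rcases h with ⟨_, h⟩ | ⟨h, _⟩
    · exact G.irrefl h
    · exact h Iff.rfl⟩

/-- The switching class of `G`. -/
def switchingClass {V : Type*} (G : SimpleGraph V) : Set (SimpleGraph V) :=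
  Set.range (seidelSwitch G)

/-- `d` is the minimum dimensionality of the switching class of `G`: the least `p + q` such that
some graph in the class has a representation in `ℝ^{p,q}` with two different distances. -/
def IsMinDimensionality {V : Type*} (G : SimpleGraph V) (d : ℕ) : Prop :=
  IsLeast {d : ℕ | ∃ H ∈ switchingClass G, ∃ a b : ℝ, ∃ p q : ℕ,
    a ≠ b ∧ p + q = d ∧ IsRepresentable H a b p q} d

/-- The data `(a, b)`, `(p, q)` agree with `(a₀, b₀)`, `(p₀, q₀)` up to scaling the distances by a
non-zero real `c`. Multiplication of all scalar squares by a negative number turns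
`ℝ^{p₀,q₀}` into `ℝ^{q₀,p₀}`. -/
def AgreeUpToScaling (a₀ b₀ : ℝ) (p₀ q₀ : ℕ) (a b : ℝ) (p q : ℕ) : Prop :=
  ∃ c : ℝ, a = c * a₀ ∧ b = c * b₀ ∧
    ((0 < c ∧ p = p₀ ∧ q = q₀) ∨ (c < 0 ∧ p = q₀ ∧ q = p₀))

/-- Among all switching sets `U` with `|U| ≤ |V| / 2`, all distances `a ≠ b` and all `(p, q)` with
`p + q = d`, the representations of the switched graph with distances `a, b` in `ℝ^{p,q}` exist
exactly in the cases described by `P U a b p q`. -/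
def AttainedExactlyBy {V : Type*} [Fintype V] (G : SimpleGraph V) (d : ℕ)
    (P : Finset V → ℝ → ℝ → ℕ → ℕ → Prop) : Prop :=
  ∀ U : Finset V, 2 * U.card ≤ Fintype.card V → ∀ a b : ℝ, a ≠ b → ∀ p q : ℕ, p + q = d →
    (IsRepresentable (seidelSwitch G U) a b p q ↔ P U a b p q)

open Classical in
/-- A Delsarte clique of a `k`-regular graph: a clique `C` with `|C| = 1 - k / ev`, where `ev` is
the smallest eigenvalue of the adjacency matrix. -/
def IsDelsarteClique {V : Type*} [Fintype V] (G : SimpleGraph V) (C : Finset V) : Prop :=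
  G.IsClique (C : Set V) ∧ ∃ k : ℕ, G.IsRegularOfDegree k ∧ ∃ ev : ℝ,
    IsLeast {x : ℝ | Module.End.HasEigenvalue (Matrix.toLin' (G.adjMatrix ℝ)) x} ev ∧
    (C.card : ℝ) = 1 - (k : ℝ) / ev

/-- `U` consists of two distinct non-adjacent vertices. -/
def IsNonadjacentPair {V : Type*} (G : SimpleGraph V) (U : Finset V) : Prop :=
  ∃ u v : V, u ≠ v ∧ ¬ G.Adj u v ∧ ∀ w : V, w ∈ U ↔ w = u ∨ w = v

/-- The subgraph induced by `U` is a 5-cycle. -/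
def InducesFiveCycle {V : Type*} (G : SimpleGraph V) (U : Finset V) : Prop :=
  Nonempty (G.induce (U : Set V) ≃g SimpleGraph.cycleGraph 5)

/-- `T` is the vertex set of a non-degenerate regular triangle. -/
def IsRegularTriangle {p q : ℕ} (T : Set (PseudoEuclidean p q)) : Prop :=
  T.ncard = 3 ∧ ∃ r : ℝ, 0 < r ∧ T.Pairwise fun x y => scalarSq (x - y) = r

/-- The vertices of `J(m,2)`: the 2-element subsets of an `m`-element set. -/
abbrev JohnsonVertex (m : ℕ) : Type := {S : Finset (Fin m) // S.card = 2}

/-- The Johnson graph `J(m,2)`: two 2-subsets are adjacent if they meet in exactly one point. -/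
def johnsonGraph (m : ℕ) : SimpleGraph (JohnsonVertex m) where
  Adj S T := (S.1 ∩ T.1).card = 1
  symm := ⟨by
    intro S T h
    rwa [Finset.inter_comm]⟩
  loopless := ⟨by
    intro S h
    rw [Finset.inter_self, S.2] at h
    omega⟩

/-!
Let `B` be the incidence matrix between the vertices of `J(m,2)`, that is, the pairs, and the `m`
points, so that `A + 2I = B Bᵀ` for the adjacency matrix `A`, and let `S = J - I - 2A`,
which is `3I + J - 2 B Bᵀ`, be the Seidel matrix. Switching with respect to `U` conjugates
`S` by the diagonal matrix of the sign vector `u` of `U`. Hence a representation `φ` of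
the switched graph with distances `a`, `b` pulls the form of `ℝ^{p,q}` back, along `x ↦ ∑ᵥ u(v) x(v) φ(v)` on the hyperplane `u^⊥`, to
half of

`(2a - b) |x|² + (b - a) |Bᵀx|² - (b - a)/2 (∑ x)²`

(`IsRepresentation.two_mul_pseudoInner`). This form does not depend on `U`, and every subspace of
`u^⊥` on which it is positive definite, negative definite or non-degenerate bounds `p`, `q` or
`p + q` from below.

If `b ≠ 2a`, the form is definite on `ker Bᵀ ∩ u^⊥`, whose dimension is at least `m(m-3)/2 - 1`.
For `m ≥ 6` this exceeds `m - 1`. A look at the complement of `ker Bᵀ` leaves, for `m = 4`,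
only `b = 0` with all points in equally many pairs of `U` and, for `m = 5`, only `a = 2b` with
`Bᵀu = 0`, which says that `U` is a 5-cycle (`IsRepresentation.four`, `IsRepresentation.five_of_ne`).

If `b = 2a`, the form is a multiple of `|y|² - (∑ y)²/8` in `y = Bᵀx`. If `u` is not in the range
of `B`, then `y` takes all values in `ℝ^m` on `u^⊥`, and the form is non-degenerate of rank `m`
unless `m = 8`, where it has signature `(7,0)`. If `u = B w`, then all sums of two coordinates of
`w` are `±1`, which forces `w` to be constant or, up to sign, `3/2` at one point and `-1/2`
elsewhere (`weights_of_switchSign_eq_edgeSum`); so `U` is trivial or a star, up to complements,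
and `y` runs through the hyperplane `w^⊥`. In the first case the form has signature `(m-1,0)`
there. In the second it is `|z|² - (∑ z)²/9` in the `m - 1` coordinates `z` away from the centre
of the star, which is positive definite, semidefinite or Lorentzian for `m < 10`, `m = 10` and
`m > 10`.

The smallest eigenvalue of `A` is `-2`, so Delsarte cliques have size `m - 1` and are the stars
for `m ≥ 5` (`isDelsarteClique_iff`). The bounds are attained by explicit vectors, with
`simplexProj` an explicit isometry from the hyperplane `∑ z = 0` of `ℝ^{k+1}` to `ℝ^k`.
-/

/-! ### The pseudo-Euclidean form and bounds on dimensions -/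

/-- The form of `ℝ^{p,q}` as a bilinear map. -/
noncomputable def pseudoForm (p q : ℕ) : LinearMap.BilinForm ℝ (PseudoEuclidean p q) :=
  LinearMap.mk₂ ℝ pseudoInner
    (by
      intro x y z
      simp only [pseudoInner, Pi.add_apply, add_mul, Finset.sum_add_distrib]
      ring)
    (by
      intro c x y
      simp only [pseudoInner, Pi.smul_apply, smul_eq_mul, mul_sub, Finset.mul_sum, mul_assoc])
    (by
      intro x y z
      simp only [pseudoInner, Pi.add_apply, mul_add, Finset.sum_add_distrib]
      ring)
    (by
      intro c x y
      simp only [pseudoInner, Pi.smul_apply, smul_eq_mul, mul_sub, Finset.mul_sum]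
      congr 1 <;> exact Finset.sum_congr rfl fun _ _ => by ring)

lemma pseudoForm_apply {p q : ℕ} (x y : PseudoEuclidean p q) :
    pseudoForm p q x y = pseudoInner x y := rfl

lemma pseudoInner_comm {p q : ℕ} (x y : PseudoEuclidean p q) :
    pseudoInner x y = pseudoInner y x := by
  simp only [pseudoInner, mul_comm]

lemma scalarSq_sub {p q : ℕ} (x y : PseudoEuclidean p q) :
    scalarSq (x - y) = scalarSq x + scalarSq y - 2 * pseudoInner x y := by
  simp only [scalarSq, ← pseudoForm_apply, map_sub, LinearMap.sub_apply]
  simp only [pseudoForm_apply, pseudoInner_comm y x]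
  ring

lemma scalarSq_eq {p q : ℕ} (x : PseudoEuclidean p q) :
    scalarSq x = ∑ i, x (Sum.inl i) ^ 2 - ∑ j, x (Sum.inr j) ^ 2 := by
  simp only [scalarSq, pseudoInner, pow_two]

lemma scalarSq_smul {p q : ℕ} (c : ℝ) (x : PseudoEuclidean p q) :
    scalarSq (c • x) = c ^ 2 * scalarSq x := by
  simp only [scalarSq_eq, Pi.smul_apply, smul_eq_mul, mul_pow, mul_sub, Finset.mul_sum]

/-- For combinations with coefficient sum zero, the form is determined by the mutual squared
distances of the points. -/
lemma two_mul_pseudoInner_combination {V : Type*} [Fintype V] {p q : ℕ}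
    (φ : V → PseudoEuclidean p q) (x y : V → ℝ) (hx : ∑ v, x v = 0) (hy : ∑ v, y v = 0) :
    2 * pseudoInner (∑ v, x v • φ v) (∑ w, y w • φ w) =
      -∑ v, ∑ w, x v * y w * scalarSq (φ v - φ w) := by
  have h1 : pseudoInner (∑ v, x v • φ v) (∑ w, y w • φ w) =
      ∑ v, ∑ w, x v * y w * pseudoInner (φ v) (φ w) := by
    rw [← pseudoForm_apply]
    simp only [map_sum, LinearMap.sum_apply, map_smul, LinearMap.smul_apply, smul_eq_mul,
      pseudoForm_apply, Finset.mul_sum]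
    rw [Finset.sum_comm]
    exact Finset.sum_congr rfl fun v _ => Finset.sum_congr rfl fun w _ => by ring
  have h2 : ∀ v w, x v * y w * scalarSq (φ v - φ w) =
      (x v * scalarSq (φ v)) * y w + x v * (y w * scalarSq (φ w)) -
        2 * (x v * y w * pseudoInner (φ v) (φ w)) := by
    intro v w
    rw [scalarSq_sub]
    ring
  simp only [h2, Finset.sum_sub_distrib, Finset.sum_add_distrib, ← Finset.mul_sum,
    ← Finset.sum_mul, hx, hy, h1]
  ring

section Dimension

variable {E : Type*} [AddCommGroup E] [Module ℝ E] {p q : ℕ}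

lemma finrank_le_of_scalarSq_pos (T : E →ₗ[ℝ] PseudoEuclidean p q)
    (h : ∀ x, x ≠ 0 → 0 < scalarSq (T x)) : Module.finrank ℝ E ≤ p := by
  let P : E →ₗ[ℝ] (Fin p → ℝ) := (LinearMap.funLeft ℝ ℝ Sum.inl).comp T
  have hP : Function.Injective P := by
    rw [← LinearMap.ker_eq_bot, LinearMap.ker_eq_bot']
    intro x hx
    by_contra hne
    have h1 := h x hne
    have h2 : ∀ i, T x (Sum.inl i) = 0 := fun i => congrFun hx i
    simp only [scalarSq_eq, h2] at h1
    have : 0 ≤ ∑ j, T x (Sum.inr j) ^ 2 := Finset.sum_nonneg fun _ _ => sq_nonneg _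
    simp at h1
    linarith
  simpa using LinearMap.finrank_le_finrank_of_injective hP

lemma finrank_le_of_scalarSq_neg (T : E →ₗ[ℝ] PseudoEuclidean p q)
    (h : ∀ x, x ≠ 0 → scalarSq (T x) < 0) : Module.finrank ℝ E ≤ q := by
  let P : E →ₗ[ℝ] (Fin q → ℝ) := (LinearMap.funLeft ℝ ℝ Sum.inr).comp T
  have hP : Function.Injective P := by
    rw [← LinearMap.ker_eq_bot, LinearMap.ker_eq_bot']
    intro x hx
    by_contra hne
    have h1 := h x hne
    have h2 : ∀ i, T x (Sum.inr i) = 0 := fun i => congrFun hx i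
    simp only [scalarSq_eq, h2] at h1
    have : 0 ≤ ∑ j, T x (Sum.inl j) ^ 2 := Finset.sum_nonneg fun _ _ => sq_nonneg _
    simp at h1
    linarith
  simpa using LinearMap.finrank_le_finrank_of_injective hP

lemma finrank_le_of_nondegenerate (T : E →ₗ[ℝ] PseudoEuclidean p q)
    (h : ∀ x, (∀ y, pseudoInner (T x) (T y) = 0) → x = 0) : Module.finrank ℝ E ≤ p + q := by
  have hT : Function.Injective T := by
    rw [← LinearMap.ker_eq_bot, LinearMap.ker_eq_bot']
    intro x hx
    refine h x fun y => ?_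
    rw [hx, ← pseudoForm_apply, map_zero, LinearMap.zero_apply]
  simpa using LinearMap.finrank_le_finrank_of_injective hT

lemma finrank_sub_le_finrank_ker {F : Type*} [AddCommGroup F] [Module ℝ F]
    [FiniteDimensional ℝ E] [FiniteDimensional ℝ F] (f : E →ₗ[ℝ] F) :
    Module.finrank ℝ E - Module.finrank ℝ F ≤ Module.finrank ℝ (LinearMap.ker f) := by
  have h1 := LinearMap.finrank_range_add_finrank_ker f
  have h2 := Submodule.finrank_le (LinearMap.range f)
  omega

end Dimension

/-! ### Rescaling and switching with respect to the complement -/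

lemma IsRepresentable.neg {V : Type*} {G : SimpleGraph V} {a b : ℝ} {p q : ℕ}
    (h : IsRepresentable G a b p q) : IsRepresentable G (-a) (-b) q p := by
  obtain ⟨φ, h1, h2⟩ := h
  have key : ∀ u v, scalarSq ((fun w s => φ w s.swap : V → PseudoEuclidean q p) u -
      (fun w s => φ w s.swap : V → PseudoEuclidean q p) v) = -scalarSq (φ u - φ v) := by
    intro u v
    simp [scalarSq_eq]
  exact ⟨fun w s => φ w s.swap, fun u v huv => by rw [key, h1 u v huv],
    fun u v hne huv => by rw [key, h2 u v hne huv]⟩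

lemma IsRepresentable.smul {V : Type*} {G : SimpleGraph V} {a b : ℝ} {p q : ℕ}
    (h : IsRepresentable G a b p q) {c : ℝ} (hc : 0 < c) :
    IsRepresentable G (c * a) (c * b) p q := by
  obtain ⟨φ, h1, h2⟩ := h
  have key : ∀ u v, scalarSq ((fun w => √c • φ w) u - (fun w => √c • φ w) v) =
      c * scalarSq (φ u - φ v) := by
    intro u v
    simp only [← smul_sub]
    rw [scalarSq_smul, Real.sq_sqrt hc.le]
  exact ⟨fun w => √c • φ w, fun u v huv => by rw [key, h1 u v huv],
    fun u v hne huv => by rw [key, h2 u v hne huv]⟩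

lemma IsRepresentable.of_agreeUpToScaling {V : Type*} {G : SimpleGraph V} {a₀ b₀ a b : ℝ}
    {p₀ q₀ p q : ℕ} (h : IsRepresentable G a₀ b₀ p₀ q₀)
    (hs : AgreeUpToScaling a₀ b₀ p₀ q₀ a b p q) : IsRepresentable G a b p q := by
  obtain ⟨c, rfl, rfl, ⟨hc, rfl, rfl⟩ | ⟨hc, rfl, rfl⟩⟩ := hs
  · exact h.smul hc
  · have := (h.smul (neg_pos.2 hc)).neg
    simpa using this

lemma AgreeUpToScaling.neg {a₀ b₀ a b : ℝ} {p₀ q₀ p q : ℕ}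
    (hs : AgreeUpToScaling a₀ b₀ p₀ q₀ a b p q) :
    AgreeUpToScaling a₀ b₀ p₀ q₀ (-a) (-b) q p := by
  obtain ⟨c, ha, hb, ⟨hc, hp, hq⟩ | ⟨hc, hp, hq⟩⟩ := hs
  · exact ⟨-c, by rw [ha]; ring, by rw [hb]; ring, Or.inr ⟨by linarith, hq, hp⟩⟩
  · exact ⟨-c, by rw [ha]; ring, by rw [hb]; ring, Or.inl ⟨by linarith, hq, hp⟩⟩

lemma AgreeUpToScaling.add_eq {a₀ b₀ a b : ℝ} {p₀ q₀ p q : ℕ}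
    (hs : AgreeUpToScaling a₀ b₀ p₀ q₀ a b p q) : p + q = p₀ + q₀ := by
  obtain ⟨c, -, -, ⟨-, rfl, rfl⟩ | ⟨-, rfl, rfl⟩⟩ := hs <;> omega

lemma AgreeUpToScaling.refl (a₀ b₀ : ℝ) (p₀ q₀ : ℕ) :
    AgreeUpToScaling a₀ b₀ p₀ q₀ a₀ b₀ p₀ q₀ :=
  ⟨1, by ring, by ring, Or.inl ⟨one_pos, rfl, rfl⟩⟩

lemma seidelSwitch_compl {V : Type*} [Fintype V] [DecidableEq V] (G : SimpleGraph V)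
    (U : Finset V) : seidelSwitch G Uᶜ = seidelSwitch G U := by
  ext u v
  simp only [seidelSwitch, Finset.mem_compl, not_iff_not]

/-- Since switching with respect to `U` and to its complement agree, the minimum dimensionality
and the list of optimal representations both follow from the classification of the
representations with `2|U| ≤ |V|`, `a < b` and dimension at most `d`. -/
lemma isMinDimensionality_and_attainedExactlyBy {V : Type*} [Fintype V]
    {G : SimpleGraph V} {d : ℕ} {P : Finset V → ℝ → ℝ → ℕ → ℕ → Prop}
    (hneg : ∀ U a b p q, P U a b p q → P U (-a) (-b) q p)
    (hadd : ∀ U a b p q, P U a b p q → p + q = d)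
    (hne : ∃ U a b p q, a ≠ b ∧ P U a b p q)
    (hrep : ∀ U a b p q, P U a b p q → IsRepresentable (seidelSwitch G U) a b p q)
    (hcls : ∀ U : Finset V, 2 * U.card ≤ Fintype.card V → ∀ a b : ℝ, a < b → ∀ p q : ℕ,
      p + q ≤ d → IsRepresentable (seidelSwitch G U) a b p q → P U a b p q) :
    IsMinDimensionality G d ∧ AttainedExactlyBy G d P := by
  classical
  have hcls' : ∀ U : Finset V, 2 * U.card ≤ Fintype.card V → ∀ a b : ℝ, a ≠ b → ∀ p q : ℕ,
      p + q ≤ d → IsRepresentable (seidelSwitch G U) a b p q → P U a b p q := by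
    intro U hU a b hab p q hpq h
    rcases lt_or_gt_of_ne hab with hlt | hlt
    · exact hcls U hU a b hlt p q hpq h
    · have := hneg _ _ _ _ _ (hcls U hU (-a) (-b) (by linarith) q p (by omega) h.neg)
      simpa using this
  refine ⟨⟨?_, ?_⟩, ?_⟩
  · obtain ⟨U, a, b, p, q, hab, h⟩ := hne
    exact ⟨_, ⟨U, rfl⟩, a, b, p, q, hab, hadd _ _ _ _ _ h, hrep _ _ _ _ _ h⟩
  · rintro e ⟨_, ⟨U, rfl⟩, a, b, p, q, hab, rfl, h⟩
    by_contra! hlt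
    by_cases hU : 2 * U.card ≤ Fintype.card V
    · have := hadd _ _ _ _ _ (hcls' U hU a b hab p q hlt.le h)
      omega
    · rw [← seidelSwitch_compl] at h
      have hU' : 2 * Uᶜ.card ≤ Fintype.card V := by
        rw [Finset.card_compl]
        omega
      have := hadd _ _ _ _ _ (hcls' Uᶜ hU' a b hab p q hlt.le h)
      omega
  · intro U hU a b hab p q hpq
    exact ⟨hcls' U hU a b hab p q hpq.le, hrep U a b p q⟩

/-! ### The incidence matrix of the complete graph -/

section Incidence

variable {m : ℕ}

/-- The vertex `v` of `J(m,2)` as a `0`-`1`-vector on the `m` points. -/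
def incidence (v : JohnsonVertex m) (i : Fin m) : ℝ := if i ∈ v.1 then 1 else 0

lemma sum_incidence_mul_incidence (v w : JohnsonVertex m) :
    ∑ i, incidence v i * incidence w i = ((v.1 ∩ w.1).card : ℝ) := by
  simp only [incidence, ← ite_and, mul_ite, mul_one, mul_zero, ← Finset.mem_inter]
  rw [Finset.sum_boole]
  congr 2
  ext i
  simp [and_comm]

lemma sum_incidence (v : JohnsonVertex m) : ∑ i, incidence v i = 2 := by
  simp only [incidence]
  rw [Finset.sum_boole]
  simp [v.2]

/-- The vertex of `J(m,2)` formed by two points. -/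
def pairVertex (i j : Fin m) (h : i ≠ j) : JohnsonVertex m := ⟨{i, j}, Finset.card_pair h⟩

lemma eq_pairVertex {v : JohnsonVertex m} {i j : Fin m} (h : i ≠ j) (hi : i ∈ v.1)
    (hj : j ∈ v.1) : v = pairVertex i j h := by
  apply Subtype.ext
  symm
  apply Finset.eq_of_subset_of_card_le
  · intro k hk
    simp only [pairVertex, Finset.mem_insert, Finset.mem_singleton] at hk
    rcases hk with rfl | rfl <;> assumption
  · rw [v.2, (pairVertex i j h).2]

lemma exists_eq_pairVertex (v : JohnsonVertex m) : ∃ i j h, v = pairVertex i j h := by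
  obtain ⟨i, j, h, hv⟩ := Finset.card_eq_two.1 v.2
  exact ⟨i, j, h, Subtype.ext hv⟩

lemma mem_pairVertex {i j k : Fin m} {h : i ≠ j} :
    k ∈ (pairVertex i j h).1 ↔ k = i ∨ k = j := by
  simp [pairVertex]

lemma sum_vertex_incidence_mul_incidence {i j : Fin m} (h : i ≠ j) :
    ∑ v : JohnsonVertex m, incidence v i * incidence v j = 1 := by
  rw [Finset.sum_eq_single (pairVertex i j h)]
  · simp [incidence, mem_pairVertex]
  · intro v _ hv
    simp only [incidence, mul_ite, mul_one, mul_zero]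
    split_ifs with h1 h2
    · exact absurd (eq_pairVertex h h2 h1) hv
    all_goals rfl
  · simp

lemma incidence_mul_self (v : JohnsonVertex m) (i : Fin m) :
    incidence v i * incidence v i = incidence v i := by
  simp [incidence]

lemma sum_vertex_incidence (i : Fin m) : ∑ v : JohnsonVertex m, incidence v i = m - 1 := by
  -- count the pairs `(v, j)` with `i, j ∈ v` in two ways
  have h1 : ∑ v : JohnsonVertex m, ∑ j, incidence v i * incidence v j =
      2 * ∑ v : JohnsonVertex m, incidence v i := by
    simp only [← Finset.mul_sum, sum_incidence]
    rw [← Finset.sum_mul, mul_comm]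
  rw [Finset.sum_comm, ← Finset.add_sum_erase _ _ (Finset.mem_univ i)] at h1
  simp only [incidence_mul_self] at h1
  rw [Finset.sum_congr rfl fun j hj =>
    sum_vertex_incidence_mul_incidence (Finset.ne_of_mem_erase hj).symm] at h1
  have h2 : 1 ≤ m := by have := i.2; omega
  simp [Finset.card_erase_of_mem, Nat.cast_sub h2] at h1
  linarith

lemma two_mul_card_johnsonVertex (m : ℕ) :
    2 * (Fintype.card (JohnsonVertex m) : ℝ) = m * (m - 1) := by
  have h1 : ∑ v : JohnsonVertex m, ∑ i, incidence v i = 2 * Fintype.card (JohnsonVertex m) := by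
    simp only [sum_incidence]
    simp [mul_comm]
  rw [← h1, Finset.sum_comm]
  simp only [sum_vertex_incidence, Finset.sum_const, Finset.card_univ, Fintype.card_fin,
    nsmul_eq_mul]

/-- The incidence map from functions on the vertices of `J(m,2)` to functions on the points. -/
def pointSum (m : ℕ) : (JohnsonVertex m → ℝ) →ₗ[ℝ] (Fin m → ℝ) where
  toFun x i := ∑ v, x v * incidence v i
  map_add' x y := by
    funext i
    simp [add_mul, Finset.sum_add_distrib]
  map_smul' c x := by
    funext i
    simp [mul_assoc, Finset.mul_sum]

/-- The transpose of `pointSum`: the value at `{i, j}` is the sum of the values at `i` and `j`. -/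
def edgeSum (m : ℕ) : (Fin m → ℝ) →ₗ[ℝ] (JohnsonVertex m → ℝ) where
  toFun w v := ∑ i, w i * incidence v i
  map_add' x y := by
    funext i
    simp [add_mul, Finset.sum_add_distrib]
  map_smul' c x := by
    funext i
    simp [mul_assoc, Finset.mul_sum]

lemma pointSum_apply (x : JohnsonVertex m → ℝ) (i : Fin m) :
    pointSum m x i = ∑ v, x v * incidence v i := rfl

lemma edgeSum_apply (w : Fin m → ℝ) (v : JohnsonVertex m) :
    edgeSum m w v = ∑ i, w i * incidence v i := rfl

lemma edgeSum_pairVertex (w : Fin m → ℝ) {i j : Fin m} (h : i ≠ j) :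
    edgeSum m w (pairVertex i j h) = w i + w j := by
  rw [edgeSum_apply, ← Finset.sum_subset (Finset.subset_univ {i, j}), Finset.sum_pair h]
  · simp [incidence, mem_pairVertex]
  · intro k _ hk
    simp only [Finset.mem_insert, Finset.mem_singleton] at hk
    simp [incidence, mem_pairVertex, hk]

lemma sum_edgeSum_mul (w : Fin m → ℝ) (x : JohnsonVertex m → ℝ) :
    ∑ v, edgeSum m w v * x v = ∑ i, w i * pointSum m x i := by
  simp only [edgeSum_apply, pointSum_apply, Finset.sum_mul, Finset.mul_sum]
  rw [Finset.sum_comm]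
  exact Finset.sum_congr rfl fun _ _ => Finset.sum_congr rfl fun _ _ => by ring

lemma sum_pointSum (x : JohnsonVertex m → ℝ) : ∑ i, pointSum m x i = 2 * ∑ v, x v := by
  simp only [pointSum_apply]
  rw [Finset.sum_comm]
  simp only [← Finset.mul_sum, sum_incidence]
  rw [← Finset.sum_mul, mul_comm]

lemma sum_edgeSum (w : Fin m → ℝ) : ∑ v, edgeSum m w v = (m - 1) * ∑ i, w i := by
  simp only [edgeSum_apply]
  rw [Finset.sum_comm]
  simp only [← Finset.mul_sum, sum_vertex_incidence]
  rw [← Finset.sum_mul, mul_comm]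

lemma pointSum_edgeSum (w : Fin m → ℝ) (i : Fin m) :
    pointSum m (edgeSum m w) i = (m - 2) * w i + ∑ j, w j := by
  simp only [pointSum_apply, edgeSum_apply, Finset.sum_mul]
  rw [Finset.sum_comm, ← Finset.add_sum_erase _ _ (Finset.mem_univ i),
    ← Finset.add_sum_erase Finset.univ w (Finset.mem_univ i)]
  simp only [mul_assoc, incidence_mul_self, ← Finset.mul_sum, sum_vertex_incidence]
  rw [Finset.sum_congr rfl fun j hj => by
    rw [sum_vertex_incidence_mul_incidence (Finset.ne_of_mem_erase hj), mul_one]]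
  ring

lemma johnsonGraph_adj {v w : JohnsonVertex m} :
    (johnsonGraph m).Adj v w ↔ (v.1 ∩ w.1).card = 1 := Iff.rfl

lemma card_inter_eq_two_iff {v w : JohnsonVertex m} : (v.1 ∩ w.1).card = 2 ↔ v = w := by
  constructor
  · intro h
    have h1 : v.1 ∩ w.1 = v.1 :=
      Finset.eq_of_subset_of_card_le Finset.inter_subset_left (by rw [h, v.2])
    have h2 : v.1 ∩ w.1 = w.1 :=
      Finset.eq_of_subset_of_card_le Finset.inter_subset_right (by rw [h, w.2])
    exact Subtype.ext (h1.symm.trans h2)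
  · rintro rfl
    rw [Finset.inter_self, v.2]

lemma card_inter_le_one {v w : JohnsonVertex m} (h : v ≠ w) : (v.1 ∩ w.1).card ≤ 1 := by
  have h1 : (v.1 ∩ w.1).card ≤ 2 := by
    exact (Finset.card_le_card Finset.inter_subset_left).trans v.2.le
  have h2 : (v.1 ∩ w.1).card ≠ 2 := fun h' => h (card_inter_eq_two_iff.1 h')
  omega

lemma card_inter_eq_zero {v w : JohnsonVertex m} (h : v ≠ w) (h' : ¬ (johnsonGraph m).Adj v w) :
    (v.1 ∩ w.1).card = 0 := by
  have h1 := card_inter_le_one h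
  rw [johnsonGraph_adj] at h'
  omega

/-! ### The quadratic form of a representation -/

/-- The `±1`-vector of a switching set: `-1` on `U` and `1` outside. -/
def switchSign (U : Finset (JohnsonVertex m)) (v : JohnsonVertex m) : ℝ := if v ∈ U then -1 else 1

lemma switchSign_mul_self (U : Finset (JohnsonVertex m)) (v : JohnsonVertex m) :
    switchSign U v * switchSign U v = 1 := by
  simp only [switchSign]
  split_ifs <;> norm_num

lemma switchSign_eq_or (U : Finset (JohnsonVertex m)) (v : JohnsonVertex m) :
    switchSign U v = 1 ∨ switchSign U v = -1 := by
  simp only [switchSign]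
  split_ifs <;> simp

/-- The functional `x ↦ ∑ᵥ u(v) x(v)` for the sign vector `u` of `U`. -/
def signedSum (U : Finset (JohnsonVertex m)) : (JohnsonVertex m → ℝ) →ₗ[ℝ] ℝ where
  toFun x := ∑ v, switchSign U v * x v
  map_add' x y := by simp [mul_add, Finset.sum_add_distrib]
  map_smul' c x := by
    simp only [Pi.smul_apply, smul_eq_mul, RingHom.id_apply, Finset.mul_sum]
    exact Finset.sum_congr rfl fun _ _ => by ring

lemma signedSum_apply (U : Finset (JohnsonVertex m)) (x : JohnsonVertex m → ℝ) :
    signedSum U x = ∑ v, switchSign U v * x v := rfl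

/-- Twice the form that a representation of a graph switched with respect to `U`, with distances
`a` and `b`, induces on the functions `x` with `signedSum U x = 0`. It does not involve `U`. -/
noncomputable def distanceForm (a b : ℝ) (x y : JohnsonVertex m → ℝ) : ℝ :=
  (2 * a - b) * ∑ v, x v * y v + (b - a) * ∑ i, pointSum m x i * pointSum m y i -
    (b - a) / 2 * ((∑ v, x v) * ∑ v, y v)

/-- All squared distances of a representation in one formula: the last factor is `-3`, `-1` or `1`
for equal, adjacent and non-adjacent vertices of `J(m,2)`. -/
lemma IsRepresentation.scalarSq_eq {U : Finset (JohnsonVertex m)} {a b : ℝ} {p q : ℕ}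
    {φ : JohnsonVertex m → PseudoEuclidean p q}
    (h : IsRepresentation (seidelSwitch (johnsonGraph m) U) a b φ) (v w : JohnsonVertex m) :
    scalarSq (φ v - φ w) = (a + b) / 2 + (b - 2 * a) * (if v = w then 1 else 0) +
      (b - a) / 2 * (switchSign U v * switchSign U w * (1 - 2 * ((v.1 ∩ w.1).card : ℝ))) := by
  by_cases hvw : v = w
  · subst hvw
    have h1 : scalarSq (φ v - φ v) = 0 := by simp [_root_.scalarSq_eq]
    rw [h1, switchSign_mul_self, Finset.inter_self, v.2]
    simp
    ring
  · rw [if_neg hvw]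
    by_cases hadj : (johnsonGraph m).Adj v w
    · rw [johnsonGraph_adj.1 hadj]
      by_cases hU : v ∈ U ↔ w ∈ U
      · rw [h.1 v w (Or.inl ⟨hU, hadj⟩)]
        have : switchSign U v * switchSign U w = 1 := by
          simp only [switchSign, hU]; split_ifs <;> norm_num
        rw [this]; push_cast; ring
      · rw [h.2 v w hvw (by rintro (⟨h1, -⟩ | ⟨-, h1⟩); exacts [hU h1, h1 hadj])]
        have : switchSign U v * switchSign U w = -1 := by
          simp only [switchSign]; split_ifs <;> simp_all
        rw [this]; push_cast; ring
    · rw [card_inter_eq_zero hvw hadj]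
      by_cases hU : v ∈ U ↔ w ∈ U
      · rw [h.2 v w hvw (by rintro (⟨-, h1⟩ | ⟨h1, -⟩); exacts [hadj h1, h1 hU])]
        have : switchSign U v * switchSign U w = 1 := by
          simp only [switchSign, hU]; split_ifs <;> norm_num
        rw [this]; push_cast; ring
      · rw [h.1 v w (Or.inr ⟨hU, hadj⟩)]
        have : switchSign U v * switchSign U w = -1 := by
          simp only [switchSign]; split_ifs <;> simp_all
        rw [this]; push_cast; ring

/-- The linear combination of the points `φ v` with coefficients `u(v) x(v)`. -/
def signedCombination (U : Finset (JohnsonVertex m)) {p q : ℕ}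
    (φ : JohnsonVertex m → PseudoEuclidean p q) :
    (JohnsonVertex m → ℝ) →ₗ[ℝ] PseudoEuclidean p q where
  toFun x := ∑ v, (switchSign U v * x v) • φ v
  map_add' x y := by simp [mul_add, add_smul, Finset.sum_add_distrib]
  map_smul' c x := by
    simp only [Pi.smul_apply, smul_eq_mul, RingHom.id_apply, Finset.smul_sum, smul_smul]
    exact Finset.sum_congr rfl fun _ _ => by congr 1; ring

lemma IsRepresentation.two_mul_pseudoInner {U : Finset (JohnsonVertex m)} {a b : ℝ} {p q : ℕ}
    {φ : JohnsonVertex m → PseudoEuclidean p q}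
    (h : IsRepresentation (seidelSwitch (johnsonGraph m) U) a b φ)
    {x y : JohnsonVertex m → ℝ} (hx : signedSum U x = 0) (hy : signedSum U y = 0) :
    2 * pseudoInner (signedCombination U φ x) (signedCombination U φ y) =
      distanceForm a b x y := by
  rw [signedSum_apply] at hx hy
  have h1 := two_mul_pseudoInner_combination φ (fun v => switchSign U v * x v)
    (fun v => switchSign U v * y v) hx hy
  refine h1.trans ?_
  have h2 : ∀ v w, switchSign U v * x v * (switchSign U w * y w) * scalarSq (φ v - φ w) =
      (a + b) / 2 * ((switchSign U v * x v) * (switchSign U w * y w)) +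
      (b - 2 * a) * (if v = w then x v * y w else 0) +
      (b - a) / 2 * (x v * y w) - (b - a) * ∑ i, (x v * incidence v i) * (y w * incidence w i) := by
    intro v w
    have e : ∑ i, (x v * incidence v i) * (y w * incidence w i) =
        x v * y w * ((v.1 ∩ w.1).card : ℝ) := by
      rw [← sum_incidence_mul_incidence, Finset.mul_sum]
      exact Finset.sum_congr rfl fun _ _ => by ring
    rw [h.scalarSq_eq, e]
    have hv := switchSign_mul_self U v
    have hw := switchSign_mul_self U w
    by_cases hvw : v = w
    · subst hvw
      simp only [if_true]
      linear_combination ((b - 2 * a) * x v * y v + (b - a) / 2 * x v * y v *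
        (1 - 2 * ((v.1 ∩ v.1).card : ℝ)) * (switchSign U v * switchSign U v + 1)) * hv
    · simp only [if_neg hvw]
      linear_combination ((b - a) / 2 * x v * y w * (1 - 2 * ((v.1 ∩ w.1).card : ℝ))) *
        (switchSign U w * switchSign U w * hv + hw)
  have h3 : ∑ v, ∑ w, ∑ i, (x v * incidence v i) * (y w * incidence w i) =
      ∑ i, pointSum m x i * pointSum m y i := by
    simp only [pointSum_apply, Finset.sum_mul_sum]
    rw [Finset.sum_congr rfl fun v _ => Finset.sum_comm, Finset.sum_comm]
  simp only [h2, Finset.sum_sub_distrib, Finset.sum_add_distrib, ← Finset.mul_sum, h3,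
    ← Finset.sum_mul, hx, hy, Finset.sum_ite_eq, Finset.mem_univ, if_true, distanceForm]
  ring

end Incidence

/-! ### Dimension bounds from the induced form -/

section Bounds

variable {m : ℕ} {U : Finset (JohnsonVertex m)} {a b : ℝ} {p q : ℕ}
  {φ : JohnsonVertex m → PseudoEuclidean p q} {E : Type*} [AddCommGroup E] [Module ℝ E]

lemma IsRepresentation.finrank_le_pos
    (h : IsRepresentation (seidelSwitch (johnsonGraph m) U) a b φ)
    (g : E →ₗ[ℝ] (JohnsonVertex m → ℝ)) (hg : ∀ e, signedSum U (g e) = 0)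
    (hpos : ∀ e, e ≠ 0 → 0 < distanceForm a b (g e) (g e)) : Module.finrank ℝ E ≤ p := by
  refine finrank_le_of_scalarSq_pos ((signedCombination U φ).comp g) fun e he => ?_
  have h1 := h.two_mul_pseudoInner (hg e) (hg e)
  have h2 := hpos e he
  rw [← h1] at h2
  rw [LinearMap.comp_apply, scalarSq]
  linarith

lemma IsRepresentation.finrank_le_neg
    (h : IsRepresentation (seidelSwitch (johnsonGraph m) U) a b φ)
    (g : E →ₗ[ℝ] (JohnsonVertex m → ℝ)) (hg : ∀ e, signedSum U (g e) = 0)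
    (hneg : ∀ e, e ≠ 0 → distanceForm a b (g e) (g e) < 0) : Module.finrank ℝ E ≤ q := by
  refine finrank_le_of_scalarSq_neg ((signedCombination U φ).comp g) fun e he => ?_
  have h1 := h.two_mul_pseudoInner (hg e) (hg e)
  have h2 := hneg e he
  rw [← h1] at h2
  rw [LinearMap.comp_apply, scalarSq]
  linarith

lemma IsRepresentation.finrank_le_add
    (h : IsRepresentation (seidelSwitch (johnsonGraph m) U) a b φ)
    (g : E →ₗ[ℝ] (JohnsonVertex m → ℝ)) (hg : ∀ e, signedSum U (g e) = 0)
    (hnd : ∀ e, (∀ e', distanceForm a b (g e) (g e') = 0) → e = 0) :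
    Module.finrank ℝ E ≤ p + q := by
  refine finrank_le_of_nondegenerate ((signedCombination U φ).comp g) fun e he => hnd e ?_
  intro e'
  rw [← h.two_mul_pseudoInner (hg e) (hg e')]
  have := he e'
  rw [LinearMap.comp_apply, LinearMap.comp_apply] at this
  rw [this, mul_zero]

/-- The vectors that are orthogonal to the sign vector of `U` and killed by the incidence map. -/
def signedKernel (U : Finset (JohnsonVertex m)) : Submodule ℝ (JohnsonVertex m → ℝ) :=
  LinearMap.ker ((pointSum m).prod (signedSum U))

lemma mem_signedKernel {x : JohnsonVertex m → ℝ} :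
    x ∈ signedKernel U ↔ pointSum m x = 0 ∧ signedSum U x = 0 := by
  simp [signedKernel]

lemma card_sub_le_finrank_signedKernel :
    Fintype.card (JohnsonVertex m) - (m + 1) ≤ Module.finrank ℝ (signedKernel U) := by
  have := finrank_sub_le_finrank_ker ((pointSum m).prod (signedSum U))
  simp only [Module.finrank_fintype_fun_eq_card, Module.finrank_prod, Module.finrank_self,
    Fintype.card_fin] at this
  exact this

lemma card_sub_le_finrank_ker_pointSum :
    Fintype.card (JohnsonVertex m) - m ≤ Module.finrank ℝ (LinearMap.ker (pointSum m)) := by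
  have := finrank_sub_le_finrank_ker (pointSum m)
  simpa using this

lemma sum_eq_zero_of_pointSum_eq_zero {x : JohnsonVertex m → ℝ} (hx : pointSum m x = 0) :
    ∑ v, x v = 0 := by
  have := sum_pointSum x
  simp [hx] at this
  exact this

lemma sum_mul_self_pos {ι : Type*} [Fintype ι] {x : ι → ℝ} (hx : x ≠ 0) :
    0 < ∑ v, x v * x v := by
  obtain ⟨i, hi⟩ := Function.ne_iff.1 hx
  exact Finset.sum_pos' (fun _ _ => mul_self_nonneg _)
    ⟨i, Finset.mem_univ i, mul_self_pos.2 hi⟩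

lemma eq_zero_of_sum_mul_self {ι : Type*} [Fintype ι] {x : ι → ℝ} (hx : ∑ v, x v * x v = 0) :
    x = 0 := by
  by_contra h
  exact (sum_mul_self_pos h).ne' hx

lemma distanceForm_of_pointSum_eq_zero {x : JohnsonVertex m → ℝ} (hx : pointSum m x = 0)
    (y : JohnsonVertex m → ℝ) :
    distanceForm a b x y = (2 * a - b) * ∑ v, x v * y v := by
  simp [distanceForm, hx, sum_eq_zero_of_pointSum_eq_zero hx]

/-- On the kernel of the incidence map, where the Seidel matrix of `J(m,2)` is the scalar `3`, the
form is definite unless `b = 2a`. -/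
lemma IsRepresentation.card_le_add
    (h : IsRepresentation (seidelSwitch (johnsonGraph m) U) a b φ) (hab : b ≠ 2 * a) :
    Fintype.card (JohnsonVertex m) - (m + 1) ≤ p + q := by
  refine (card_sub_le_finrank_signedKernel (U := U)).trans
    (h.finrank_le_add (signedKernel U).subtype (fun e => (mem_signedKernel.1 e.2).2) ?_)
  intro e he
  have h1 := he e
  rw [Submodule.subtype_apply, distanceForm_of_pointSum_eq_zero (mem_signedKernel.1 e.2).1,
    mul_eq_zero] at h1
  rcases h1 with h1 | h1
  · exact absurd (by linarith) hab
  · exact Subtype.ext (eq_zero_of_sum_mul_self h1)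

/-- A function on the points is signed liftable if it is the image under the incidence map of a
vector orthogonal to the sign vector of `U`. -/
def IsSignedLiftable (U : Finset (JohnsonVertex m)) (y : Fin m → ℝ) : Prop :=
  ∃ x, pointSum m x = y ∧ signedSum U x = 0

lemma exists_linear_lift (E : Submodule ℝ (Fin m → ℝ)) (hE : ∀ y ∈ E, IsSignedLiftable U y) :
    ∃ g : E →ₗ[ℝ] (JohnsonVertex m → ℝ),
      ∀ y, pointSum m (g y) = y ∧ signedSum U (g y) = 0 := by
  let M := (pointSum m).prod (signedSum U)
  obtain ⟨r, hr⟩ := M.rangeRestrict.exists_rightInverse_of_surjective M.range_rangeRestrict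
  let i : E →ₗ[ℝ] LinearMap.range M := LinearMap.codRestrict _
    ((LinearMap.inl ℝ (Fin m → ℝ) ℝ).comp E.subtype) (by
      rintro ⟨y, hy⟩
      obtain ⟨x, h1, h2⟩ := hE y hy
      exact ⟨x, Prod.ext h1 h2⟩)
  refine ⟨r.comp i, fun y => ?_⟩
  have h1 : M (r (i y)) = ((y : Fin m → ℝ), (0 : ℝ)) :=
    congrArg Subtype.val (LinearMap.congr_fun hr (i y))
  exact ⟨congrArg Prod.fst h1, congrArg Prod.snd h1⟩

lemma distanceForm_two_mul (x y : JohnsonVertex m → ℝ) :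
    distanceForm a (2 * a) x y = a * (∑ i, pointSum m x i * pointSum m y i -
      (∑ i, pointSum m x i) * (∑ i, pointSum m y i) / 8) := by
  rw [distanceForm, sum_pointSum, sum_pointSum]
  ring

lemma IsRepresentation.finrank_le_pos_of_liftable
    (h : IsRepresentation (seidelSwitch (johnsonGraph m) U) a (2 * a) φ) (ha : 0 < a)
    (E : Submodule ℝ (Fin m → ℝ)) (hE : ∀ y ∈ E, IsSignedLiftable U y)
    (hpos : ∀ y ∈ E, y ≠ 0 → 0 < ∑ i, y i * y i - (∑ i, y i) * (∑ i, y i) / 8) :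
    Module.finrank ℝ E ≤ p := by
  obtain ⟨g, hg⟩ := exists_linear_lift E hE
  refine h.finrank_le_pos g (fun y => (hg y).2) fun y hy => ?_
  rw [distanceForm_two_mul, (hg y).1]
  exact mul_pos ha (hpos y y.2 (by simpa using hy))

lemma IsRepresentation.finrank_le_neg_of_liftable
    (h : IsRepresentation (seidelSwitch (johnsonGraph m) U) a (2 * a) φ) (ha : 0 < a)
    (E : Submodule ℝ (Fin m → ℝ)) (hE : ∀ y ∈ E, IsSignedLiftable U y)
    (hneg : ∀ y ∈ E, y ≠ 0 → ∑ i, y i * y i - (∑ i, y i) * (∑ i, y i) / 8 < 0) :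
    Module.finrank ℝ E ≤ q := by
  obtain ⟨g, hg⟩ := exists_linear_lift E hE
  refine h.finrank_le_neg g (fun y => (hg y).2) fun y hy => ?_
  rw [distanceForm_two_mul, (hg y).1]
  exact mul_neg_of_pos_of_neg ha (hneg y y.2 (by simpa using hy))

/-- The vector with all coordinates `1` spans the radical of `|y|² - (∑ y)²/8` if `m = 8`;
otherwise the form is non-degenerate. -/
lemma IsRepresentation.le_add_of_liftable
    (h : IsRepresentation (seidelSwitch (johnsonGraph m) U) a (2 * a) φ) (ha : 0 < a)
    (hU : ∀ y, IsSignedLiftable U y) (hm : m ≠ 8) : m ≤ p + q := by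
  obtain ⟨g, hg⟩ := exists_linear_lift (U := U) ⊤ fun y _ => hU y
  have h1 := h.finrank_le_add g (fun y => (hg y).2) ?_
  · simpa using h1
  intro y hy
  have h2 : ∀ j, (y : Fin m → ℝ) j = (∑ i, (y : Fin m → ℝ) i) / 8 := by
    intro j
    have h3 := hy ⟨Pi.single j 1, trivial⟩
    rw [distanceForm_two_mul, (hg _).1, (hg _).1, mul_eq_zero, or_iff_right ha.ne'] at h3
    simp [Pi.single_apply] at h3
    linarith
  have h4 : ∑ i, (y : Fin m → ℝ) i = m * ((∑ i, (y : Fin m → ℝ) i) / 8) := by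
    conv_lhs => rw [Finset.sum_congr rfl fun j _ => h2 j]
    simp
  have h5 : ((m : ℝ) - 8) * ∑ i, (y : Fin m → ℝ) i = 0 := by linarith
  rw [mul_eq_zero, or_iff_right (sub_ne_zero.2 (by exact_mod_cast hm))] at h5
  refine Subtype.ext (funext fun j => ?_)
  rw [h2, h5]
  simp

/-- The functional adding up all coordinates. -/
def coordSum (m : ℕ) : (Fin m → ℝ) →ₗ[ℝ] ℝ := ∑ i, LinearMap.proj i

lemma coordSum_apply (y : Fin m → ℝ) : coordSum m y = ∑ i, y i := by
  simp [coordSum, LinearMap.sum_apply]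

lemma IsRepresentation.sub_one_le_pos_of_sum_eq_zero
    (h : IsRepresentation (seidelSwitch (johnsonGraph m) U) a (2 * a) φ) (ha : 0 < a)
    (hU : ∀ y, ∑ i, y i = 0 → IsSignedLiftable U y) : m - 1 ≤ p := by
  have h1 := finrank_sub_le_finrank_ker (coordSum m)
  simp only [Module.finrank_fin_fun, Module.finrank_self] at h1
  refine h1.trans (h.finrank_le_pos_of_liftable ha _ (fun y hy => hU y ?_) ?_)
  · rwa [LinearMap.mem_ker, coordSum_apply] at hy
  · intro y hy hne
    rw [LinearMap.mem_ker, coordSum_apply] at hy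
    rw [hy]
    have := sum_mul_self_pos hne
    linarith

/-- In the star case the form is `|y|² - 2 y(i)²` on the vectors with `∑ y = 4 y(i)`; it is positive
definite for `m < 10` by the Cauchy-Schwarz inequality. -/
lemma IsRepresentation.sub_one_le_pos_of_star
    (h : IsRepresentation (seidelSwitch (johnsonGraph m) U) a (2 * a) φ) (ha : 0 < a)
    {i : Fin m} (hU : ∀ y, ∑ j, y j = 4 * y i → IsSignedLiftable U y) (hm : m ≤ 9) :
    m - 1 ≤ p := by
  have h1 := finrank_sub_le_finrank_ker (coordSum m - (4 : ℝ) • LinearMap.proj i)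
  simp only [Module.finrank_fin_fun, Module.finrank_self] at h1
  have hmem : ∀ y, y ∈ LinearMap.ker (coordSum m - (4 : ℝ) • LinearMap.proj i) →
      ∑ j, y j = 4 * y i := by
    intro y hy
    simp [coordSum_apply] at hy
    linarith
  refine h1.trans (h.finrank_le_pos_of_liftable ha _ (fun y hy => hU y (hmem y hy)) ?_)
  intro y hy hne
  have h2 := hmem y hy
  have h3 : 0 < ∑ j, y j * y j := sum_mul_self_pos hne
  have h4 := sq_sum_le_card_mul_sum_sq (s := Finset.univ.erase i) (f := y)
  rw [h2]
  rw [← Finset.add_sum_erase _ _ (Finset.mem_univ i)] at h2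
  rw [← Finset.add_sum_erase _ _ (Finset.mem_univ i)] at h3 ⊢
  have h5 : ∑ j ∈ Finset.univ.erase i, y j = 3 * y i := by linarith
  rw [h5, Finset.card_erase_of_mem (Finset.mem_univ i), Finset.card_univ, Fintype.card_fin] at h4
  simp only [pow_two] at h4
  set t := ∑ j ∈ Finset.univ.erase i, y j * y j with ht
  have h6 : 0 ≤ t := Finset.sum_nonneg fun _ _ => mul_self_nonneg _
  have h7 : ((m - 1 : ℕ) : ℝ) ≤ 8 := by exact_mod_cast (by omega : m - 1 ≤ 8)
  have h8 : 9 * (y i * y i) ≤ 8 * t := by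
    have := mul_le_mul_of_nonneg_right h7 h6
    linarith
  have h9 := mul_self_nonneg (y i)
  by_cases h10 : y i * y i = 0
  · linarith
  · have := lt_of_le_of_ne h9 (Ne.symm h10)
    linarith

lemma IsRepresentation.sub_two_le_pos_of_star
    (h : IsRepresentation (seidelSwitch (johnsonGraph m) U) a (2 * a) φ) (ha : 0 < a)
    {i : Fin m} (hU : ∀ y, ∑ j, y j = 4 * y i → IsSignedLiftable U y) : m - 2 ≤ p := by
  have h1 := finrank_sub_le_finrank_ker ((coordSum m).prod (LinearMap.proj i))
  simp only [Module.finrank_fin_fun, Module.finrank_self, Module.finrank_prod] at h1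
  have hmem : ∀ y, y ∈ LinearMap.ker ((coordSum m).prod (LinearMap.proj i)) →
      ∑ j, y j = 0 ∧ y i = 0 := by
    intro y hy
    simpa [coordSum_apply] using hy
  refine h1.trans (h.finrank_le_pos_of_liftable ha _ (fun y hy => hU y ?_) ?_)
  · rw [(hmem y hy).1, (hmem y hy).2, mul_zero]
  · intro y hy hne
    rw [(hmem y hy).1]
    have := sum_mul_self_pos hne
    linarith

lemma IsRepresentation.one_le_neg_of_star
    (h : IsRepresentation (seidelSwitch (johnsonGraph m) U) a (2 * a) φ) (ha : 0 < a)
    {i : Fin m} (hU : ∀ y, ∑ j, y j = 4 * y i → IsSignedLiftable U y) (hm : 11 ≤ m) : 1 ≤ q := by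
  -- the vector with all other coordinates equal is negative for `m > 10`
  let z : Fin m → ℝ := fun j => if j = i then ((m : ℝ) - 1) / 3 else 1
  have hzi : z i = ((m : ℝ) - 1) / 3 := by simp [z]
  have hcard : ((Finset.univ.erase i).card : ℝ) = m - 1 := by
    rw [Finset.card_erase_of_mem (Finset.mem_univ i), Finset.card_univ, Fintype.card_fin,
      Nat.cast_sub (by omega), Nat.cast_one]
  have hz : ∀ j ∈ Finset.univ.erase i, z j = 1 := fun j hj => by
    simp [z, Finset.ne_of_mem_erase hj]
  have hsum : ∑ j, z j = 4 * z i := by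
    rw [← Finset.add_sum_erase _ _ (Finset.mem_univ i), Finset.sum_congr rfl hz]
    simp only [Finset.sum_const, nsmul_eq_mul, mul_one, hcard, hzi]
    ring
  have hsq : ∑ j, z j * z j = (((m : ℝ) - 1) / 3) ^ 2 + (m - 1) := by
    rw [← Finset.add_sum_erase _ _ (Finset.mem_univ i),
      Finset.sum_congr rfl fun j hj => by rw [hz j hj]]
    simp only [Finset.sum_const, nsmul_eq_mul, mul_one, hcard, hzi]
    ring
  have hz0 : z ≠ 0 := by
    intro h0
    have h1 := congrFun h0 i
    rw [hzi] at h1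
    have : (11 : ℝ) ≤ m := by exact_mod_cast hm
    simp at h1
    linarith
  rw [← finrank_span_singleton (K := ℝ) hz0]
  refine h.finrank_le_neg_of_liftable ha _ (fun y hy => hU y ?_) ?_
  · obtain ⟨c, rfl⟩ := Submodule.mem_span_singleton.1 hy
    simp only [Pi.smul_apply, smul_eq_mul, ← Finset.mul_sum, hsum]
    ring
  · intro y hy hne
    obtain ⟨c, rfl⟩ := Submodule.mem_span_singleton.1 hy
    have hc : c ≠ 0 := by
      rintro rfl
      simp at hne
    have e : ∑ j, (c • z) j * (c • z) j - (∑ j, (c • z) j) * (∑ j, (c • z) j) / 8 =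
        c ^ 2 * (∑ j, z j * z j - (∑ j, z j) * (∑ j, z j) / 8) := by
      have : ∀ j, (c • z) j * (c • z) j = c ^ 2 * (z j * z j) := fun j => by
        simp only [Pi.smul_apply, smul_eq_mul]; ring
      simp only [this]
      simp only [Pi.smul_apply, smul_eq_mul, ← Finset.mul_sum]
      ring
    rw [e, hsum, hsq, hzi]
    have : (11 : ℝ) ≤ m := by exact_mod_cast hm
    refine mul_neg_of_pos_of_neg (by positivity) ?_
    nlinarith

end Bounds

/-! ### Sign vectors in the range of the incidence map -/

section SignVectors

variable {m : ℕ} {U : Finset (JohnsonVertex m)}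

/-- The star of the point `i`: all pairs containing `i`. -/
def pointStar (i : Fin m) : Finset (JohnsonVertex m) := Finset.univ.filter fun v => i ∈ v.1

lemma mem_pointStar {i : Fin m} {v : JohnsonVertex m} : v ∈ pointStar i ↔ i ∈ v.1 := by
  simp [pointStar]

lemma card_pointStar (i : Fin m) : (pointStar i).card = m - 1 := by
  have h1 := sum_vertex_incidence i
  simp only [incidence] at h1
  rw [Finset.sum_boole] at h1
  have h2 : 1 ≤ m := by have := i.2; omega
  have h3 : ((pointStar i).card : ℝ) = ((m - 1 : ℕ) : ℝ) := by
    rw [Nat.cast_sub h2, Nat.cast_one]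
    exact h1
  exact_mod_cast h3

lemma exists_functional_of_not_surjective {E F : Type*} [AddCommGroup E] [Module ℝ E]
    [AddCommGroup F] [Module ℝ F] (f : E →ₗ[ℝ] F) (hf : ¬ Function.Surjective f) :
    ∃ g : F →ₗ[ℝ] ℝ, g ≠ 0 ∧ ∀ x, g (f x) = 0 := by
  rw [← LinearMap.range_eq_top] at hf
  obtain ⟨g, hg, hle⟩ := Submodule.exists_le_ker_of_lt_top _ (lt_top_iff_ne_top.2 hf)
  exact ⟨g, hg, fun x => hle (LinearMap.mem_range_self f x)⟩

lemma eq_zero_of_edgeSum_eq_zero (hm : 3 ≤ m) {w : Fin m → ℝ} (hw : edgeSum m w = 0) :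
    w = 0 := by
  have h1 : ∀ i, ((m : ℝ) - 2) * w i + ∑ j, w j = 0 := fun i => by
    rw [← pointSum_edgeSum, hw, map_zero, Pi.zero_apply]
  have h2 : ∑ j, w j = 0 := by
    have h3 := sum_edgeSum w
    rw [hw] at h3
    have h4 : (3 : ℝ) ≤ m := by exact_mod_cast hm
    simp only [Pi.zero_apply, Finset.sum_const_zero] at h3
    exact (mul_eq_zero.1 h3.symm).resolve_left (by linarith)
  funext i
  have h3 := h1 i
  have h4 : (3 : ℝ) ≤ m := by exact_mod_cast hm
  rw [h2, add_zero] at h3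
  exact (mul_eq_zero.1 h3).resolve_left (by linarith)

lemma functional_apply_eq_sum {n : ℕ} (g : (Fin n → ℝ) →ₗ[ℝ] ℝ) (y : Fin n → ℝ) :
    g y = ∑ i, g (Pi.single i 1) * y i := by
  conv_lhs => rw [pi_eq_sum_univ' y, map_sum]
  refine Finset.sum_congr rfl fun i _ => ?_
  rw [map_smul, smul_eq_mul, mul_comm]

lemma pointSum_surjective (hm : 3 ≤ m) : Function.Surjective (pointSum m) := by
  by_contra h
  obtain ⟨g, hg, h0⟩ := exists_functional_of_not_surjective _ h
  have h1 : edgeSum m (fun i => g (Pi.single i 1)) = 0 := by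
    apply eq_zero_of_sum_mul_self
    rw [sum_edgeSum_mul, ← functional_apply_eq_sum, h0]
  have h2 := eq_zero_of_edgeSum_eq_zero hm h1
  apply hg
  ext i
  simpa using congrFun h2 i

/-- Either the sign vector of `U` is independent of the rows of the incidence matrix, or it lies
in their span. -/
lemma forall_isSignedLiftable_or_exists_edgeSum (hm : 3 ≤ m) :
    (∀ y, IsSignedLiftable U y) ∨ ∃ w, ∀ v, switchSign U v = edgeSum m w v := by
  by_cases hs : Function.Surjective ((pointSum m).prod (signedSum U))
  · left
    intro y
    obtain ⟨x, hx⟩ := hs (y, 0)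
    exact ⟨x, congrArg Prod.fst hx, congrArg Prod.snd hx⟩
  right
  obtain ⟨g, hg, h0⟩ := exists_functional_of_not_surjective _ hs
  set w : Fin m → ℝ := fun i => (g.comp (LinearMap.inl ℝ _ _)) (Pi.single i 1) with hw
  set s : ℝ := g (0, 1) with hs
  have hgen : ∀ y t, g (y, t) = ∑ i, w i * y i + s * t := by
    intro y t
    have e : ((y, t) : (Fin m → ℝ) × ℝ) =
        LinearMap.inl ℝ _ _ y + t • ((0, 1) : (Fin m → ℝ) × ℝ) := by
      simp
    rw [e, map_add, map_smul, ← LinearMap.comp_apply, functional_apply_eq_sum, smul_eq_mul,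
      mul_comm t]
  have h1 : ∀ x : JohnsonVertex m → ℝ, ∑ v, (edgeSum m w v + s * switchSign U v) * x v = 0 := by
    intro x
    have h2 : g (pointSum m x, signedSum U x) = 0 := h0 x
    rw [hgen, signedSum_apply, ← sum_edgeSum_mul] at h2
    rw [← h2, Finset.mul_sum, ← Finset.sum_add_distrib]
    exact Finset.sum_congr rfl fun _ _ => by ring
  have h2 : ∀ v, edgeSum m w v + s * switchSign U v = 0 := fun v =>
    congrFun (eq_zero_of_sum_mul_self (h1 _)) v
  by_cases hs0 : s = 0
  · exfalso
    have h3 : w = 0 := eq_zero_of_edgeSum_eq_zero hm (funext fun v => by simpa [hs0] using h2 v)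
    refine hg (LinearMap.ext fun ⟨y, t⟩ => ?_)
    rw [hgen, h3, hs0]
    simp
  · refine ⟨(-s⁻¹) • w, fun v => ?_⟩
    rw [map_smul, Pi.smul_apply, smul_eq_mul]
    have h3 := h2 v
    field_simp
    linarith

/-- If all pairwise sums of `w` are `±1`, then up to sign `w` is constant `1/2`, or it is `3/2` at
one point and `-1/2` elsewhere. -/
lemma weights_of_switchSign_eq_edgeSum (hm : 3 ≤ m) {w : Fin m → ℝ}
    (hw : ∀ v, switchSign U v = edgeSum m w v) :
    ∃ ε : ℝ, (ε = 1 ∨ ε = -1) ∧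
      ((∀ i, w i = ε / 2) ∨ ∃ i, ∀ j, w j = if j = i then 3 / 2 * ε else -ε / 2) := by
  have hpair : ∀ i j, i ≠ j → w i + w j = 1 ∨ w i + w j = -1 := by
    intro i j h
    rw [← edgeSum_pairVertex w h, ← hw]
    exact switchSign_eq_or U _
  -- `2 w(i) = (w(i) + w(j)) + (w(i) + w(k)) - (w(j) + w(k))` is odd of absolute value at most `3`
  have hval : ∀ i, w i = 1 / 2 ∨ w i = -1 / 2 ∨ w i = 3 / 2 ∨ w i = -3 / 2 := by
    intro i
    obtain ⟨j, hj⟩ : ∃ j : Fin m, j ∉ ({i} : Finset (Fin m)) := by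
      by_contra! h
      have := Finset.card_le_card (fun x _ => h x : (Finset.univ : Finset (Fin m)) ⊆ _)
      simp at this
      omega
    obtain ⟨k, hk⟩ : ∃ k : Fin m, k ∉ ({i, j} : Finset (Fin m)) := by
      by_contra! h
      have := Finset.card_le_card (fun x _ => h x : (Finset.univ : Finset (Fin m)) ⊆ _)
      have h2 := Finset.card_le_two (a := i) (b := j)
      simp only [Finset.card_univ, Fintype.card_fin] at this
      omega
    simp only [Finset.mem_singleton, Finset.mem_insert, not_or] at hj hk
    rcases hpair i j (Ne.symm hj) with h1 | h1 <;> rcases hpair i k (Ne.symm hk.1) with h2 | h2 <;>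
      rcases hpair j k (Ne.symm hk.2) with h3 | h3
    · left; linarith
    · right; right; left; linarith
    · right; left; linarith
    · left; linarith
    · right; left; linarith
    · left; linarith
    · right; right; right; linarith
    · right; left; linarith
  by_cases hbig : ∃ i, w i = 3 / 2 ∨ w i = -3 / 2
  · obtain ⟨i, hi⟩ := hbig
    obtain ⟨ε, hε, hi⟩ : ∃ ε : ℝ, (ε = 1 ∨ ε = -1) ∧ w i = 3 / 2 * ε := by
      rcases hi with hi | hi
      · exact ⟨1, Or.inl rfl, by rw [hi]; ring⟩
      · exact ⟨-1, Or.inr rfl, by rw [hi]; ring⟩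
    refine ⟨ε, hε, Or.inr ⟨i, fun j => ?_⟩⟩
    split_ifs with hji
    · rw [hji, hi]
    · rcases hε with rfl | rfl <;> rcases hpair i j (Ne.symm hji) with h1 | h1 <;>
        rcases hval j with h2 | h2 | h2 | h2 <;> linarith
  · push Not at hbig
    have hhalf : ∀ i, w i = 1 / 2 ∨ w i = -1 / 2 := fun i => by
      rcases hval i with h | h | h | h
      · exact Or.inl h
      · exact Or.inr h
      · exact absurd h (hbig i).1
      · exact absurd h (hbig i).2
    let i₀ : Fin m := ⟨0, by omega⟩
    refine ⟨2 * w i₀, ?_, Or.inl fun j => ?_⟩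
    · rcases hhalf i₀ with h | h <;> rw [h]
      · left; norm_num
      · right; norm_num
    · by_cases hj : i₀ = j
      · rw [hj]; ring
      · rcases hpair i₀ j hj with h1 | h1 <;> rcases hhalf i₀ with h2 | h2 <;>
          rcases hhalf j with h3 | h3 <;> linarith

/-- For every switching set the sign vector is independent of the incidence matrix, or constant, or
constant on a star and on its complement. -/
lemma switchingSet_trichotomy (hm : 4 ≤ m) (U : Finset (JohnsonVertex m)) :
    (∀ y, IsSignedLiftable U y) ∨
    ((U = ∅ ∨ U = Finset.univ) ∧ ∀ y, ∑ j, y j = 0 → IsSignedLiftable U y) ∨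
    ∃ i, (U = pointStar i ∨ U = (pointStar i)ᶜ) ∧
      ∀ y, ∑ j, y j = 4 * y i → IsSignedLiftable U y := by
  rcases forall_isSignedLiftable_or_exists_edgeSum (U := U) (by omega) with h | ⟨w, hw⟩
  · exact Or.inl h
  right
  have hlift : ∀ y, ∑ j, w j * y j = 0 → IsSignedLiftable U y := by
    intro y hy
    obtain ⟨x, rfl⟩ := pointSum_surjective (by omega) y
    refine ⟨x, rfl, ?_⟩
    rw [signedSum_apply, ← hy, ← sum_edgeSum_mul]
    exact Finset.sum_congr rfl fun v _ => by rw [hw]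
  obtain ⟨ε, hε, hc | ⟨i, hi⟩⟩ := weights_of_switchSign_eq_edgeSum (by omega) hw
  · refine Or.inl ⟨?_, fun y hy => hlift y ?_⟩
    · have hs : ∀ v, switchSign U v = ε := by
        intro v
        obtain ⟨j, k, hjk, rfl⟩ := exists_eq_pairVertex v
        rw [hw, edgeSum_pairVertex, hc, hc]
        ring
      rcases hε with rfl | rfl
      · left
        rw [Finset.eq_empty_iff_forall_notMem]
        intro v hv
        have := hs v
        simp only [switchSign, if_pos hv] at this
        norm_num at this
      · right
        rw [Finset.eq_univ_iff_forall]
        intro v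
        by_contra hv
        have := hs v
        simp only [switchSign, if_neg hv] at this
        norm_num at this
    · simp only [hc, ← Finset.mul_sum, hy, mul_zero]
  · refine Or.inr ⟨i, ?_, fun y hy => hlift y ?_⟩
    · have hs : ∀ v, switchSign U v = if i ∈ v.1 then ε else -ε := by
        intro v
        obtain ⟨j, k, hjk, rfl⟩ := exists_eq_pairVertex v
        rw [hw, edgeSum_pairVertex, hi, hi]
        simp only [mem_pairVertex]
        by_cases h1 : j = i
        · subst h1
          simp [hjk.symm]
          ring
        · by_cases h2 : k = i
          · subst h2
            simp [hjk]
            ring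
          · simp [h1, h2, Ne.symm h1, Ne.symm h2]
      rcases hε with rfl | rfl
      · right
        ext v
        have := hs v
        rw [Finset.mem_compl, mem_pointStar]
        simp only [switchSign] at this
        by_cases h1 : v ∈ U <;> by_cases h2 : i ∈ v.1 <;> simp [h1, h2] at this ⊢ <;>
          norm_num at this
      · left
        ext v
        have := hs v
        rw [mem_pointStar]
        simp only [switchSign] at this
        by_cases h1 : v ∈ U <;> by_cases h2 : i ∈ v.1 <;> simp [h1, h2] at this ⊢ <;>
          norm_num at this
    -- `w · y = 0` amounts to `3 y(i) = ∑ y(j)` over `j ≠ i`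
    · have : ∀ j, w j * y j = -ε / 2 * y j + if j = i then 2 * ε * y i else 0 := by
        intro j
        rw [hi]
        split_ifs with h
        · rw [h]; ring
        · ring
      simp only [this, Finset.sum_add_distrib, ← Finset.mul_sum, hy, Finset.sum_ite_eq',
        Finset.mem_univ, if_true]
      ring

end SignVectors

/-! ### Delsarte cliques of `J(m,2)` -/

section Delsarte

variable {m : ℕ}

lemma adjMatrix_mulVec_johnsonGraph [DecidableRel (johnsonGraph m).Adj]
    (x : JohnsonVertex m → ℝ) (v : JohnsonVertex m) :
    ((johnsonGraph m).adjMatrix ℝ).mulVec x v = edgeSum m (pointSum m x) v - 2 * x v := by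
  have h1 : edgeSum m (pointSum m x) v = ∑ w, x w * ((v.1 ∩ w.1).card : ℝ) := by
    simp only [edgeSum_apply, pointSum_apply, Finset.sum_mul]
    rw [Finset.sum_comm]
    refine Finset.sum_congr rfl fun w _ => ?_
    rw [← sum_incidence_mul_incidence, Finset.mul_sum]
    exact Finset.sum_congr rfl fun _ _ => by ring
  have h2 : ∀ w, x w * ((v.1 ∩ w.1).card : ℝ) =
      (johnsonGraph m).adjMatrix ℝ v w * x w + if v = w then 2 * x w else 0 := by
    intro w
    rw [SimpleGraph.adjMatrix_apply]
    by_cases hvw : v = w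
    · subst hvw
      rw [card_inter_eq_two_iff.2 rfl]
      simp [mul_comm]
    · by_cases hadj : (johnsonGraph m).Adj v w
      · rw [johnsonGraph_adj.1 hadj]
        simp [hadj, hvw]
      · rw [card_inter_eq_zero hvw hadj]
        simp [hadj, hvw]
  rw [h1, Finset.sum_congr rfl fun w _ => h2 w, Finset.sum_add_distrib]
  simp [Matrix.mulVec, dotProduct]

lemma degree_johnsonGraph [DecidableRel (johnsonGraph m).Adj] (v : JohnsonVertex m) :
    (johnsonGraph m).degree v = 2 * (m - 2) := by
  have hm : 2 ≤ m := by
    have := Finset.card_le_univ v.1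
    rwa [v.2, Fintype.card_fin] at this
  have h1 := adjMatrix_mulVec_johnsonGraph (Function.const _ 1) v
  rw [SimpleGraph.adjMatrix_mulVec_const_apply] at h1
  have h2 : pointSum m (Function.const (JohnsonVertex m) (1 : ℝ)) = fun _ => (m : ℝ) - 1 := by
    funext i
    simp [pointSum_apply, sum_vertex_incidence]
  rw [h2, edgeSum_apply, ← Finset.mul_sum, sum_incidence] at h1
  have h3 : ((johnsonGraph m).degree v : ℝ) = ((2 * (m - 2) : ℕ) : ℝ) := by
    push_cast [Nat.cast_sub hm]
    simp at h1
    linarith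
  exact_mod_cast h3

lemma isLeast_eigenvalue_johnsonGraph (hm : 4 ≤ m) [DecidableRel (johnsonGraph m).Adj]
    [DecidableEq (JohnsonVertex m)] :
    IsLeast {x : ℝ | Module.End.HasEigenvalue
      (Matrix.toLin' ((johnsonGraph m).adjMatrix ℝ)) x} (-2) := by
  constructor
  · have h1 := card_sub_le_finrank_ker_pointSum (m := m)
    have h2 := two_mul_card_johnsonVertex m
    have h3 : m < Fintype.card (JohnsonVertex m) := by
      have h4 : (4 : ℝ) ≤ m := by exact_mod_cast hm
      have h5 : (m : ℝ) < Fintype.card (JohnsonVertex m) := by nlinarith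
      exact_mod_cast h5
    have h4 : LinearMap.ker (pointSum m) ≠ ⊥ := by
      intro h
      rw [h, finrank_bot] at h1
      omega
    obtain ⟨x, hx, hx0⟩ := Submodule.exists_mem_ne_zero_of_ne_bot h4
    refine Module.End.hasEigenvalue_of_hasEigenvector (x := x)
      ⟨Module.End.mem_eigenspace_iff.2 ?_, hx0⟩
    rw [Matrix.toLin'_apply]
    funext v
    rw [adjMatrix_mulVec_johnsonGraph, LinearMap.mem_ker.1 hx, map_zero]
    simp
  · intro μ hμ
    obtain ⟨x, hx, hx0⟩ := hμ.exists_hasEigenvector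
    rw [Module.End.mem_eigenspace_iff, Matrix.toLin'_apply] at hx
    have h1 : ∀ v, edgeSum m (pointSum m x) v = (μ + 2) * x v := by
      intro v
      have h2 := congrFun hx v
      rw [adjMatrix_mulVec_johnsonGraph, Pi.smul_apply, smul_eq_mul] at h2
      linarith
    have h2 := sum_edgeSum_mul (pointSum m x) x
    simp only [h1, mul_assoc, ← Finset.mul_sum] at h2
    have h3 : 0 ≤ ∑ i, pointSum m x i * pointSum m x i :=
      Finset.sum_nonneg fun _ _ => mul_self_nonneg _
    rw [← h2] at h3
    have := nonneg_of_mul_nonneg_left h3 (sum_mul_self_pos hx0)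
    linarith

lemma isClique_pointStar (i : Fin m) :
    (johnsonGraph m).IsClique (pointStar i : Set (JohnsonVertex m)) := by
  intro v hv w hw hvw
  rw [Finset.mem_coe, mem_pointStar] at hv hw
  have h1 := card_inter_le_one hvw
  have h2 : 0 < (v.1 ∩ w.1).card := Finset.card_pos.2 ⟨i, Finset.mem_inter.2 ⟨hv, hw⟩⟩
  rw [johnsonGraph_adj]
  omega

lemma exists_eq_pointStar_of_isClique (hm : 5 ≤ m) {U : Finset (JohnsonVertex m)}
    (hU : (johnsonGraph m).IsClique (U : Set (JohnsonVertex m))) (hcard : U.card = m - 1) :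
    ∃ i, U = pointStar i := by
  have hmeet : ∀ v ∈ U, ∀ w ∈ U, ∃ i, i ∈ v.1 ∧ i ∈ w.1 := by
    intro v hv w hw
    by_cases hvw : v = w
    · subst hvw
      obtain ⟨i, hi⟩ := Finset.card_pos.1 (by rw [v.2]; norm_num : 0 < v.1.card)
      exact ⟨i, hi, hi⟩
    · have h1 := johnsonGraph_adj.1 (hU hv hw hvw)
      obtain ⟨i, hi⟩ := Finset.card_pos.1 (by omega : 0 < (v.1 ∩ w.1).card)
      exact ⟨i, Finset.mem_inter.1 hi⟩
  obtain ⟨v, hv, w, hw, hvw⟩ := Finset.one_lt_card.1 (by omega : 1 < U.card)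
  obtain ⟨i, hiv, hiw⟩ := hmeet v hv w hw
  have hall : ∀ x ∈ U, i ∈ x.1 := by
    intro x hx
    by_contra hix
    obtain ⟨j, hjv, hjx⟩ := hmeet v hv x hx
    obtain ⟨k, hkw, hkx⟩ := hmeet w hw x hx
    have hij : i ≠ j := fun h => hix (h ▸ hjx)
    have hik : i ≠ k := fun h => hix (h ▸ hkx)
    have hv' := eq_pairVertex hij hiv hjv
    have hw' := eq_pairVertex hik hiw hkw
    have hjk : j ≠ k := by
      rintro rfl
      exact hvw (hv'.trans hw'.symm)
    have hx' := eq_pairVertex hjk hjx hkx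
    -- now `v`, `w`, `x` form a triangle, and a fourth pair cannot meet all three of them
    have hsub : U ⊆ {v, w, x} := by
      intro y hy
      obtain ⟨s, hsv, hsy⟩ := hmeet v hv y hy
      obtain ⟨t, htw, hty⟩ := hmeet w hw y hy
      obtain ⟨r, hrx, hry⟩ := hmeet x hx y hy
      rw [hv', mem_pairVertex] at hsv
      rw [hw', mem_pairVertex] at htw
      rw [hx', mem_pairVertex] at hrx
      simp only [Finset.mem_insert, Finset.mem_singleton]
      rcases hsv with rfl | rfl <;> rcases htw with rfl | rfl <;> rcases hrx with rfl | rfl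
      · left; rw [hv']; exact eq_pairVertex _ hsy hry
      · right; left; rw [hw']; exact eq_pairVertex _ hsy hry
      · right; left; rw [hw']; exact eq_pairVertex _ hsy hty
      · right; left; rw [hw']; exact eq_pairVertex _ hsy hty
      · left; rw [hv']; exact eq_pairVertex _ hty hsy
      · left; rw [hv']; exact eq_pairVertex _ hty hsy
      · right; right; rw [hx']; exact eq_pairVertex _ hsy hty
      · right; right; rw [hx']; exact eq_pairVertex _ hsy hty
    have h1 := Finset.card_le_card hsub
    have h2 := Finset.card_le_three (a := v) (b := w) (c := x)
    omega
  refine ⟨i, Finset.eq_of_subset_of_card_le (fun x hx => mem_pointStar.2 (hall x hx)) ?_⟩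
  rw [card_pointStar, hcard]

/-- The smallest eigenvalue `-2` and the degree `2(m-2)` give size `m - 1`, and for `m ≥ 5` the only
cliques of that size are the stars. -/
lemma isDelsarteClique_iff (hm : 5 ≤ m) {U : Finset (JohnsonVertex m)} :
    IsDelsarteClique (johnsonGraph m) U ↔ ∃ i, U = pointStar i := by
  classical
  have hcast : ((2 * (m - 2) : ℕ) : ℝ) = 2 * ((m : ℝ) - 2) := by
    push_cast [Nat.cast_sub (by omega : 2 ≤ m)]
    ring
  have hcast1 : ((m - 1 : ℕ) : ℝ) = (m : ℝ) - 1 := by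
    push_cast [Nat.cast_sub (by omega : 1 ≤ m)]
    ring
  constructor
  · rintro ⟨hcl, k, hk, ev, hev, hcard⟩
    apply exists_eq_pointStar_of_isClique hm hcl
    have h1 : ev = -2 := hev.unique (isLeast_eigenvalue_johnsonGraph (by omega))
    let v : JohnsonVertex m := pairVertex ⟨0, by omega⟩ ⟨1, by omega⟩ (by simp)
    have h2 : k = 2 * (m - 2) := (hk v).symm.trans (degree_johnsonGraph v)
    rw [h1, h2, hcast] at hcard
    have h3 : (U.card : ℝ) = ((m - 1 : ℕ) : ℝ) := by
      rw [hcard, hcast1]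
      ring
    exact_mod_cast h3
  · rintro ⟨i, rfl⟩
    refine ⟨isClique_pointStar i, 2 * (m - 2), fun v => degree_johnsonGraph v, -2,
      isLeast_eigenvalue_johnsonGraph (by omega), ?_⟩
    rw [card_pointStar, hcast, hcast1]
    ring

end Delsarte

/-! ### Construction of representations -/

section Construction

/-- An explicit linear map `ℝ^{k+1} → ℝ^k` that kills the all-one vector and is isometric on its
orthogonal complement. -/
noncomputable def simplexProj (k : ℕ) : (Fin (k + 1) → ℝ) →ₗ[ℝ] (Fin k → ℝ) where
  toFun z i := z i.castSucc + (1 / √(k + 1) - 1) / k * ∑ j : Fin k, z j.castSucc -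
    1 / √(k + 1) * z (Fin.last k)
  map_add' x y := by
    funext i
    simp only [Pi.add_apply, Finset.sum_add_distrib]
    ring
  map_smul' c x := by
    funext i
    simp only [Pi.smul_apply, smul_eq_mul, ← Finset.mul_sum, RingHom.id_apply]
    ring

lemma sum_simplexProj_sq {k : ℕ} (hk : 0 < k) (z : Fin (k + 1) → ℝ) :
    ∑ i, simplexProj k z i ^ 2 = ∑ i, z i ^ 2 - (∑ i, z i) ^ 2 / (k + 1) := by
  have hk' : (0 : ℝ) < k := by exact_mod_cast hk
  set β := 1 / √((k : ℝ) + 1) with hβ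
  have hβ2 : β ^ 2 * (k + 1) = 1 := by
    rw [hβ, div_pow, Real.sq_sqrt (by positivity)]
    field_simp
  set s := ∑ j : Fin k, z j.castSucc with hs
  set t := (β - 1) / k * s - β * z (Fin.last k) with ht
  have h1 : ∀ i, simplexProj k z i ^ 2 = z i.castSucc ^ 2 + 2 * t * z i.castSucc + t ^ 2 := by
    intro i
    have : simplexProj k z i = z i.castSucc + t := by
      simp only [simplexProj, LinearMap.coe_mk, AddHom.coe_mk, ht, hs, hβ]
      ring
    rw [this]
    ring
  simp only [h1, Finset.sum_add_distrib, ← Finset.mul_sum, ← hs, Finset.sum_const,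
    Finset.card_univ, Fintype.card_fin, nsmul_eq_mul]
  rw [Fin.sum_univ_castSucc, Fin.sum_univ_castSucc, ← hs]
  have h2 : (s + z (Fin.last k)) ^ 2 / ((k : ℝ) + 1) = β ^ 2 * (s + z (Fin.last k)) ^ 2 := by
    rw [div_eq_iff (by positivity)]
    linear_combination -(s + z (Fin.last k)) ^ 2 * hβ2
  have h3 : (k : ℝ) * t = (β - 1) * s - k * β * z (Fin.last k) := by
    rw [ht]
    field_simp
  have h4 : (k : ℝ) * (2 * t * s + k * t ^ 2) =
      k * (z (Fin.last k) ^ 2 - β ^ 2 * (s + z (Fin.last k)) ^ 2) := by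
    have : (k : ℝ) * (2 * t * s + k * t ^ 2) = 2 * s * (k * t) + (k * t) ^ 2 := by ring
    rw [this, h3]
    linear_combination (s ^ 2 + k * z (Fin.last k) ^ 2) * hβ2
  have h5 := mul_left_cancel₀ hk'.ne' h4
  rw [h2]
  linarith

variable {m : ℕ} {U : Finset (JohnsonVertex m)}

lemma isRepresentation_of_scalarSq {a b : ℝ} {p q : ℕ} {φ : JohnsonVertex m → PseudoEuclidean p q}
    (h : ∀ v w, v ≠ w → scalarSq (φ v - φ w) = (a + b) / 2 +
      (b - a) / 2 * (switchSign U v * switchSign U w * (1 - 2 * ((v.1 ∩ w.1).card : ℝ)))) :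
    IsRepresentation (seidelSwitch (johnsonGraph m) U) a b φ := by
  constructor
  · rintro v w (⟨hU, hadj⟩ | ⟨hU, hadj⟩)
    · rw [h v w hadj.ne, johnsonGraph_adj.1 hadj]
      have : switchSign U v * switchSign U w = 1 := by
        simp only [switchSign, hU]; split_ifs <;> norm_num
      rw [this]; push_cast; ring
    · have hvw : v ≠ w := by rintro rfl; exact hU Iff.rfl
      rw [h v w hvw, card_inter_eq_zero hvw hadj]
      have : switchSign U v * switchSign U w = -1 := by
        simp only [switchSign]; split_ifs <;> simp_all
      rw [this]; push_cast; ring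
  · intro v w hvw hnadj
    by_cases hadj : (johnsonGraph m).Adj v w
    · have hU : ¬ (v ∈ U ↔ w ∈ U) := fun hU => hnadj (Or.inl ⟨hU, hadj⟩)
      rw [h v w hvw, johnsonGraph_adj.1 hadj]
      have : switchSign U v * switchSign U w = -1 := by
        simp only [switchSign]; split_ifs <;> simp_all
      rw [this]; push_cast; ring
    · have hU : v ∈ U ↔ w ∈ U := by
        by_contra hU
        exact hnadj (Or.inr ⟨hU, hadj⟩)
      rw [h v w hvw, card_inter_eq_zero hvw hadj]
      have : switchSign U v * switchSign U w = 1 := by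
        simp only [switchSign, hU]; split_ifs <;> norm_num
      rw [this]; push_cast; ring

lemma sum_sub_incidence_sq (v w : JohnsonVertex m) (c d : ℝ) :
    ∑ i, (c * incidence v i - d * incidence w i) ^ 2 =
      2 * c ^ 2 + 2 * d ^ 2 - 2 * c * d * ((v.1 ∩ w.1).card : ℝ) := by
  have h1 : ∀ i, (c * incidence v i - d * incidence w i) ^ 2 =
      c ^ 2 * incidence v i + d ^ 2 * incidence w i -
        2 * c * d * (incidence v i * incidence w i) := by
    intro i
    have hv := incidence_mul_self v i
    have hw := incidence_mul_self w i
    linear_combination c ^ 2 * hv + d ^ 2 * hw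
  simp only [h1, Finset.sum_sub_distrib, Finset.sum_add_distrib, ← Finset.mul_sum, sum_incidence,
    sum_incidence_mul_incidence]
  ring

lemma switchSign_empty (v : JohnsonVertex m) : switchSign ∅ v = 1 := by simp [switchSign]

lemma isRepresentable_one_two_of_two_four {p q : ℕ}
    (h : IsRepresentable (seidelSwitch (johnsonGraph m) U) 2 4 p q) :
    IsRepresentable (seidelSwitch (johnsonGraph m) U) 1 2 p q := by
  have := h.smul (c := 1 / 2) (by norm_num)
  norm_num at this
  exact this

/-- Up to scaling, the vertices `{i, j}` are represented by the midpoints of the edges of a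
regular simplex. -/
lemma isRepresentable_empty (hm : 2 ≤ m) :
    IsRepresentable (seidelSwitch (johnsonGraph m) ∅) 1 2 (m - 1) 0 := by
  obtain ⟨k, rfl⟩ : ∃ k, m = k + 1 := ⟨m - 1, by omega⟩
  rw [Nat.add_sub_cancel]
  refine isRepresentable_one_two_of_two_four
    ⟨fun v => Sum.elim (simplexProj k (incidence v)) Fin.elim0,
      isRepresentation_of_scalarSq fun v w hvw => ?_⟩
  have h1 := sum_simplexProj_sq (by omega : 0 < k) (incidence v - incidence w)
  simp only [map_sub, Pi.sub_apply, Finset.sum_sub_distrib, sum_incidence] at h1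
  have h2 := sum_sub_incidence_sq v w 1 1
  simp only [one_mul] at h2
  rw [scalarSq_eq]
  simp only [Pi.sub_apply, Sum.elim_inl, Finset.univ_eq_empty, Finset.sum_empty, switchSign_empty,
    h1, h2]
  ring

/-- For `m = 8` the midpoints of the edges of a regular simplex centred at the origin span
equiangular lines, and every switching amounts to replacing some of the vectors by their
negatives. -/
lemma isRepresentable_eight (U : Finset (JohnsonVertex 8)) :
    IsRepresentable (seidelSwitch (johnsonGraph 8) U) 1 2 7 0 := by
  refine isRepresentable_one_two_of_two_four
    ⟨fun v => Sum.elim (simplexProj 7 (switchSign U v • incidence v)) Fin.elim0,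
      isRepresentation_of_scalarSq fun v w hvw => ?_⟩
  have h1 := sum_simplexProj_sq (by omega : 0 < 7)
    (switchSign U v • incidence v - switchSign U w • incidence w)
  rw [map_sub] at h1
  simp only [Pi.sub_apply, Pi.smul_apply, smul_eq_mul, Finset.sum_sub_distrib, ← Finset.mul_sum,
    sum_incidence, sum_sub_incidence_sq] at h1
  rw [scalarSq_eq]
  simp only [Pi.sub_apply, Sum.elim_inl, Finset.univ_eq_empty, Finset.sum_empty, h1]
  push_cast
  have hv := switchSign_mul_self U v
  have hw := switchSign_mul_self U w
  linear_combination 3 / 2 * hv + 3 / 2 * hw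

/-- The coordinates of a vertex away from the point `i`, negated off the star of `i`. -/
def starVector {n : ℕ} (i : Fin (n + 1)) (v : JohnsonVertex (n + 1)) : Fin n → ℝ :=
  fun j => -(switchSign (pointStar i) v) * incidence v (i.succAbove j)

lemma switchSign_pointStar (i : Fin m) (v : JohnsonVertex m) :
    switchSign (pointStar i) v = 1 - 2 * incidence v i := by
  simp only [switchSign, mem_pointStar, incidence]
  split_ifs <;> norm_num

lemma sum_starVector_sub {n : ℕ} (i : Fin (n + 1)) (v w : JohnsonVertex (n + 1)) :
    ∑ j, (starVector i v - starVector i w) j = 3 * (incidence v i - incidence w i) := by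
  have h1 : ∀ v : JohnsonVertex (n + 1), ∑ j, incidence v (i.succAbove j) = 2 - incidence v i := by
    intro v
    rw [← sum_incidence v, Fin.sum_univ_succAbove _ i]
    ring
  simp only [Pi.sub_apply, starVector, Finset.sum_sub_distrib, ← Finset.mul_sum, h1,
    switchSign_pointStar]
  have hv := incidence_mul_self v i
  have hw := incidence_mul_self w i
  linear_combination -2 * hv + 2 * hw

/-- Since `sum_starVector_sub` gives the subtracted square as `(∑ z)²/9`, the
differences `z` of the star vectors have the required values of `|z|² - (∑ z)²/9`. -/
lemma sum_starVector_sub_sq {n : ℕ} (i : Fin (n + 1)) (v w : JohnsonVertex (n + 1)) :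
    ∑ j, (starVector i v - starVector i w) j ^ 2 - (incidence v i - incidence w i) ^ 2 =
      3 + switchSign (pointStar i) v * switchSign (pointStar i) w *
        (1 - 2 * ((v.1 ∩ w.1).card : ℝ)) := by
  have h1 := sum_sub_incidence_sq v w (-(switchSign (pointStar i) v))
    (-(switchSign (pointStar i) w))
  rw [Fin.sum_univ_succAbove _ i] at h1
  have h2 : ∑ j, (starVector i v - starVector i w) j ^ 2 =
      2 * (-(switchSign (pointStar i) v)) ^ 2 + 2 * (-(switchSign (pointStar i) w)) ^ 2 -
        2 * (-(switchSign (pointStar i) v)) * (-(switchSign (pointStar i) w)) *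
          ((v.1 ∩ w.1).card : ℝ) - (-(switchSign (pointStar i) v) * incidence v i -
            -(switchSign (pointStar i) w) * incidence w i) ^ 2 := by
    rw [← h1]
    simp only [Pi.sub_apply, starVector]
    ring
  rw [h2]
  simp only [switchSign_pointStar, incidence]
  split_ifs <;> ring

/-- By `sum_simplexProj_sq` the form `|z|² - (∑ z)²/9` on `ℝ^{k+1}` splits into the square of the
projection to `ℝ^k` and `1/(k+1) - 1/9` times `(∑ z)²`; the sign of that factor distinguishes
`m = k + 2` below, at and above `10`. -/
lemma isRepresentable_star_of_lt_ten {k : ℕ} (hk : 0 < k) (hk' : k ≤ 7) (i : Fin (k + 1 + 1)) :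
    IsRepresentable (seidelSwitch (johnsonGraph (k + 1 + 1)) (pointStar i)) 1 2 (k + 1) 0 := by
  have hc : (0 : ℝ) ≤ 1 / ((k : ℝ) + 1) - 1 / 9 := by
    have : (k : ℝ) ≤ 7 := by exact_mod_cast hk'
    rw [sub_nonneg]
    apply one_div_le_one_div_of_le <;> linarith [(Nat.cast_nonneg k : (0 : ℝ) ≤ k)]
  refine isRepresentable_one_two_of_two_four
    ⟨fun v => Sum.elim (Fin.cons (√(1 / ((k : ℝ) + 1) - 1 / 9) * ∑ j, starVector i v j)
      (simplexProj k (starVector i v)) : Fin (k + 1) → ℝ) Fin.elim0,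
      isRepresentation_of_scalarSq fun v w hvw => ?_⟩
  have h1 := sum_simplexProj_sq hk (starVector i v - starVector i w)
  have h2 := sum_starVector_sub i v w
  have h3 := sum_starVector_sub_sq i v w
  rw [h2, map_sub] at h1
  rw [scalarSq_eq, Fin.sum_univ_succ]
  simp only [Pi.sub_apply, Sum.elim_inl, Finset.univ_eq_empty, Finset.sum_empty,
    Fin.cons_zero, Fin.cons_succ] at h1 h2 h3 ⊢
  rw [Finset.sum_sub_distrib] at h2
  rw [h1, ← mul_sub, h2]
  linear_combination h3 + 9 * (incidence v i - incidence w i) ^ 2 * Real.sq_sqrt hc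

lemma isRepresentable_star_ten (i : Fin 10) :
    IsRepresentable (seidelSwitch (johnsonGraph 10) (pointStar i)) 1 2 8 0 := by
  refine isRepresentable_one_two_of_two_four
    ⟨fun v => Sum.elim (simplexProj 8 (starVector i v)) Fin.elim0,
      isRepresentation_of_scalarSq fun v w hvw => ?_⟩
  have h1 := sum_simplexProj_sq (by omega : 0 < 8) (starVector i v - starVector i w)
  have h2 := sum_starVector_sub i v w
  have h3 := sum_starVector_sub_sq i v w
  rw [h2, map_sub] at h1
  rw [scalarSq_eq]
  simp only [Pi.sub_apply, Sum.elim_inl, Finset.univ_eq_empty, Finset.sum_empty] at h1 h3 ⊢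
  rw [h1]
  push_cast
  linear_combination h3

lemma isRepresentable_star_of_ten_lt {k : ℕ} (hk : 9 ≤ k) (i : Fin (k + 1 + 1)) :
    IsRepresentable (seidelSwitch (johnsonGraph (k + 1 + 1)) (pointStar i)) 1 2 k 1 := by
  have hc : (0 : ℝ) ≤ 1 / 9 - 1 / ((k : ℝ) + 1) := by
    have : (9 : ℝ) ≤ k := by exact_mod_cast hk
    rw [sub_nonneg]
    apply one_div_le_one_div_of_le <;> linarith
  refine isRepresentable_one_two_of_two_four
    ⟨fun v => Sum.elim (simplexProj k (starVector i v))
      (fun _ => √(1 / 9 - 1 / ((k : ℝ) + 1)) * ∑ j, starVector i v j),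
      isRepresentation_of_scalarSq fun v w hvw => ?_⟩
  have h1 := sum_simplexProj_sq (by omega : 0 < k) (starVector i v - starVector i w)
  have h2 := sum_starVector_sub i v w
  have h3 := sum_starVector_sub_sq i v w
  rw [h2, map_sub] at h1
  rw [scalarSq_eq]
  simp only [Pi.sub_apply, Sum.elim_inl, Sum.elim_inr, Finset.univ_unique, Finset.sum_singleton]
    at h1 h2 h3 ⊢
  rw [Finset.sum_sub_distrib] at h2
  rw [h1, ← mul_sub, h2]
  linear_combination h3 - 9 * (incidence v i - incidence w i) ^ 2 * Real.sq_sqrt hc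

end Construction

/-! ### Five-cycles in `J(5,2)` -/

section FiveCycle

/-- The points `i` and `j` are consecutive on the standard 5-cycle. -/
def IsCyclicPair (i j : Fin 5) : Prop := j = i + 1 ∨ i = j + 1

instance : DecidableRel IsCyclicPair := fun i j =>
  inferInstanceAs (Decidable (j = i + 1 ∨ i = j + 1))

/-- A 2-regular graph on five points is a 5-cycle. -/
lemma exists_cyclic_order (e : Fin 5 → Fin 5 → ℕ) (hsymm : ∀ i j, e i j = e j i)
    (hdiag : ∀ i, e i i = 0) (hle : ∀ i j, e i j ≤ 1) (hsum : ∀ i, ∑ j, e i j = 2) :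
    ∃ f : Equiv.Perm (Fin 5), ∀ i j, e (f i) (f j) = if IsCyclicPair i j then 1 else 0 := by
  -- `a`, `b` are the neighbours of `0`, and `c`, `d` the remaining points
  have hA : ((Finset.univ.filter fun j => e 0 j = 1).card) = 2 := by
    rw [Finset.card_filter, ← hsum 0]
    refine Finset.sum_congr rfl fun j _ => ?_
    have := hle 0 j
    split_ifs <;> omega
  obtain ⟨a, b, hab, hAab⟩ := Finset.card_eq_two.1 hA
  have hmem : ∀ j, e 0 j = 1 ↔ j = a ∨ j = b := by
    intro j
    have : j ∈ Finset.univ.filter (fun j => e 0 j = 1) ↔ j ∈ ({a, b} : Finset (Fin 5)) := by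
      rw [hAab]
    simpa using this
  have ha0 : (0 : Fin 5) ≠ a := by
    rintro rfl
    have := (hmem 0).2 (Or.inl rfl)
    rw [hdiag] at this
    omega
  have hb0 : (0 : Fin 5) ≠ b := by
    rintro rfl
    have := (hmem 0).2 (Or.inr rfl)
    rw [hdiag] at this
    omega
  have hC : (({0, a, b} : Finset (Fin 5))ᶜ).card = 2 := by
    rw [Finset.card_compl, Finset.card_eq_three.2 ⟨0, a, b, ha0, hb0, hab, rfl⟩]
    rfl
  obtain ⟨c, d, hcd, hCcd⟩ := Finset.card_eq_two.1 hC
  have hc : c ∈ ({0, a, b} : Finset (Fin 5))ᶜ := by rw [hCcd]; simp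
  have hd : d ∈ ({0, a, b} : Finset (Fin 5))ᶜ := by rw [hCcd]; simp
  simp only [Finset.mem_compl, Finset.mem_insert, Finset.mem_singleton, not_or] at hc hd
  have hinj : Function.Injective ![0, a, c, d, b] := by
    intro i j hij
    fin_cases i <;> fin_cases j <;> simp_all
  let f : Equiv.Perm (Fin 5) := Equiv.ofBijective _ (Finite.injective_iff_bijective.1 hinj)
  have hrow : ∀ i, ∑ j, e (f i) (f j) = 2 := fun i => by
    rw [Equiv.sum_comp f (e (f i)), hsum]
  have h01 : e (f 0) (f 1) = 1 := (hmem _).2 (Or.inl rfl)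
  have h04 : e (f 0) (f 4) = 1 := (hmem _).2 (Or.inr rfl)
  have hrow0 := hrow 0
  have hrow1 := hrow 1
  have hrow2 := hrow 2
  have hrow3 := hrow 3
  have hrow4 := hrow 4
  simp only [Fin.sum_univ_five, hdiag, hsymm (f 1) (f 0), hsymm (f 2) (f 0), hsymm (f 3) (f 0),
    hsymm (f 4) (f 0), hsymm (f 2) (f 1), hsymm (f 3) (f 1), hsymm (f 4) (f 1),
    hsymm (f 3) (f 2), hsymm (f 4) (f 2), hsymm (f 4) (f 3)] at hrow0 hrow1 hrow2 hrow3 hrow4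
  have l12 := hle (f 1) (f 2)
  have l13 := hle (f 1) (f 3)
  have l14 := hle (f 1) (f 4)
  have l23 := hle (f 2) (f 3)
  have l24 := hle (f 2) (f 4)
  have l34 := hle (f 3) (f 4)
  have h02 : e (f 0) (f 2) = 0 := by omega
  have h03 : e (f 0) (f 3) = 0 := by omega
  have h23 : e (f 2) (f 3) = 1 := by omega
  have h14 : e (f 1) (f 4) = 0 := by omega
  by_cases h12 : e (f 1) (f 2) = 1
  · have h13 : e (f 1) (f 3) = 0 := by omega
    have h24 : e (f 2) (f 4) = 0 := by omega
    have h34 : e (f 3) (f 4) = 1 := by omega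
    refine ⟨f, fun i j => ?_⟩
    fin_cases i <;> fin_cases j <;>
      first
      | exact hdiag _
      | assumption
      | (refine (hsymm _ _).trans ?_; assumption)
  · have h12 : e (f 1) (f 2) = 0 := by omega
    have h13 : e (f 1) (f 3) = 1 := by omega
    have h24 : e (f 2) (f 4) = 1 := by omega
    have h34 : e (f 3) (f 4) = 0 := by omega
    refine ⟨(Equiv.swap 2 3).trans f, fun i j => ?_⟩
    have s0 : (Equiv.swap (2 : Fin 5) 3) 0 = 0 := by decide
    have s1 : (Equiv.swap (2 : Fin 5) 3) 1 = 1 := by decide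
    have s2 : (Equiv.swap (2 : Fin 5) 3) 2 = 3 := by decide
    have s3 : (Equiv.swap (2 : Fin 5) 3) 3 = 2 := by decide
    have s4 : (Equiv.swap (2 : Fin 5) 3) 4 = 4 := by decide
    simp only [Equiv.trans_apply]
    fin_cases i <;> fin_cases j <;>
      simp only [Fin.zero_eta, Fin.mk_one, Fin.reduceFinMk, s0, s1, s2, s3, s4] <;>
      first
      | exact hdiag _
      | assumption
      | (refine (hsymm _ _).trans ?_; assumption)

lemma pointSum_switchSign {m : ℕ} (U : Finset (JohnsonVertex m)) (i : Fin m) :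
    pointSum m (switchSign U) i = m - 1 - 2 * ∑ v ∈ U, incidence v i := by
  have h1 : ∀ v, switchSign U v * incidence v i =
      incidence v i - 2 * if v ∈ U then incidence v i else 0 := by
    intro v
    simp only [switchSign]
    split_ifs <;> ring
  simp only [pointSum_apply, h1, Finset.sum_sub_distrib, ← Finset.mul_sum, sum_vertex_incidence,
    Finset.sum_ite_mem, Finset.univ_inter]

lemma pair_inter_card_perm (f : Equiv.Perm (Fin 5)) (i j k l : Fin 5) :
    (({f i, f j} : Finset (Fin 5)) ∩ {f k, f l}).card =
      (({i, j} : Finset (Fin 5)) ∩ {k, l}).card := by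
  have h : ∀ x y, ({f x, f y} : Finset (Fin 5)) = ({x, y} : Finset (Fin 5)).map f.toEmbedding := by
    intro x y
    simp
  rw [h, h, ← Finset.map_inter, Finset.card_map]

/-- If every point lies on as many pairs of `U` as off `U`, then `U` is the edge set of a
5-cycle. -/
lemma exists_perm_of_pointSum_eq_zero {U : Finset (JohnsonVertex 5)}
    (hU : pointSum 5 (switchSign U) = 0) :
    ∃ f : Equiv.Perm (Fin 5), ∀ i j (h : f i ≠ f j),
      pairVertex (f i) (f j) h ∈ U ↔ IsCyclicPair i j := by
  classical
  let e : Fin 5 → Fin 5 → ℕ := fun i j =>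
    if h : i ≠ j then if pairVertex i j h ∈ U then 1 else 0 else 0
  have hswap : ∀ (i j : Fin 5) (h : i ≠ j), pairVertex j i h.symm = pairVertex i j h := fun i j h =>
    Subtype.ext (Finset.pair_comm j i)
  have he : ∀ i j, i ≠ j → (e i j : ℝ) = ∑ v ∈ U, incidence v i * incidence v j := by
    intro i j h
    simp only [e, dif_pos h]
    have h1 : ∀ v, incidence v i * incidence v j = if v = pairVertex i j h then 1 else 0 := by
      intro v
      split_ifs with hv
      · simp [hv, incidence, mem_pairVertex]
      · simp only [incidence, mul_ite, mul_one, mul_zero]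
        split_ifs with h2 h3
        · exact absurd (eq_pairVertex h h3 h2) hv
        all_goals rfl
    simp only [h1, Finset.sum_ite_eq']
    push_cast
    rfl
  obtain ⟨f, hf⟩ := exists_cyclic_order e
    (by
      intro i j
      by_cases h : i = j
      · subst h; rfl
      · simp only [e, dif_pos h, dif_pos (Ne.symm h), hswap i j h])
    (by intro i; simp [e])
    (by
      intro i j
      simp only [e]
      split_ifs <;> omega)
    (by
      intro i
      have h1 : ∑ j, (e i j : ℝ) = 2 := by
        rw [← Finset.add_sum_erase _ _ (Finset.mem_univ i)]
        have h0 : e i i = 0 := by simp [e]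
        rw [h0, Finset.sum_congr rfl fun j hj => he i j (Finset.ne_of_mem_erase hj).symm,
          Finset.sum_comm]
        have h2 : ∀ v : JohnsonVertex 5,
            ∑ j ∈ Finset.univ.erase i, incidence v i * incidence v j = incidence v i := by
          intro v
          have h3 := sum_incidence v
          rw [← Finset.add_sum_erase _ _ (Finset.mem_univ i)] at h3
          rw [← Finset.mul_sum]
          have h4 := incidence_mul_self v i
          linear_combination incidence v i * h3 - h4
        simp only [h2]
        have h3 := congrFun hU i
        rw [pointSum_switchSign] at h3
        simp at h3
        simp
        linarith
      exact_mod_cast h1)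
  refine ⟨f, fun i j h => ?_⟩
  have h1 := hf i j
  simp only [e, dif_pos h] at h1
  split_ifs at h1 <;> simp_all

lemma inducesFiveCycle_of_perm {U : Finset (JohnsonVertex 5)} {f : Equiv.Perm (Fin 5)}
    (hf : ∀ i j (h : f i ≠ f j), pairVertex (f i) (f j) h ∈ U ↔ IsCyclicPair i j) :
    InducesFiveCycle (johnsonGraph 5) U := by
  have hsucc : ∀ i : Fin 5, i ≠ i + 1 := by decide
  have hne : ∀ i : Fin 5, f i ≠ f (i + 1) := fun i h => hsucc i (f.injective h)
  let ψ : Fin 5 → (U : Set (JohnsonVertex 5)) := fun i =>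
    ⟨pairVertex (f i) (f (i + 1)) (hne i), (hf i (i + 1) (hne i)).2 (Or.inl rfl)⟩
  have hcard : ∀ i j, ((ψ i).1.1 ∩ (ψ j).1.1).card =
      (({i, i + 1} : Finset (Fin 5)) ∩ {j, j + 1}).card := fun i j =>
    pair_inter_card_perm f i (i + 1) j (j + 1)
  have hinj : Function.Injective ψ := by
    intro i j hij
    have h1 := hcard i j
    rw [hij, card_inter_eq_two_iff.2 rfl] at h1
    have h2 : ∀ i j : Fin 5, 2 = (({i, i + 1} : Finset (Fin 5)) ∩ {j, j + 1}).card → i = j := by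
      decide
    exact h2 i j h1
  have hsurj : Function.Surjective ψ := by
    rintro ⟨v, hv⟩
    obtain ⟨x, y, hxy, rfl⟩ := exists_eq_pairVertex v
    obtain ⟨i, rfl⟩ := f.surjective x
    obtain ⟨j, rfl⟩ := f.surjective y
    rcases (hf i j hxy).1 hv with rfl | rfl
    · exact ⟨i, rfl⟩
    · exact ⟨j, Subtype.ext (Subtype.ext (Finset.pair_comm _ _))⟩
  have hadj : ∀ i j : Fin 5, (({i, i + 1} : Finset (Fin 5)) ∩ {j, j + 1}).card = 1 ↔
      (SimpleGraph.cycleGraph 5).Adj i j := by decide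
  refine ⟨RelIso.symm ⟨Equiv.ofBijective ψ ⟨hinj, hsurj⟩, fun {i j} => ?_⟩⟩
  rw [← hadj i j, ← hcard i j]
  exact Iff.rfl

/-- Counting: the degrees `d` of a 5-cycle in `J(5,2)` satisfy `∑ d = 10` and `∑ d² = 20`, so
`∑ (d - 2)² = 0`. -/
lemma pointSum_eq_zero_of_inducesFiveCycle {U : Finset (JohnsonVertex 5)}
    (hU : InducesFiveCycle (johnsonGraph 5) U) : pointSum 5 (switchSign U) = 0 := by
  obtain ⟨ψ⟩ := hU
  let y : Fin 5 → JohnsonVertex 5 := fun i => (ψ.symm i).1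
  have hsum : ∀ i, ∑ v ∈ U, incidence v i = ∑ j, incidence (y j) i := by
    intro i
    rw [← Finset.sum_coe_sort]
    exact (Equiv.sum_comp ψ.symm.toEquiv (fun v : (U : Set (JohnsonVertex 5)) =>
      incidence v.1 i)).symm
  have hcard : ∀ i j, ((y i).1 ∩ (y j).1).card =
      if i = j then 2 else if (SimpleGraph.cycleGraph 5).Adj i j then 1 else 0 := by
    intro i j
    by_cases hij : i = j
    · rw [if_pos hij, hij, card_inter_eq_two_iff.2 rfl]
    · have hne : y i ≠ y j := fun h => hij (ψ.symm.injective (Subtype.ext h))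
      have hadj : (johnsonGraph 5).Adj (y i) (y j) ↔ (SimpleGraph.cycleGraph 5).Adj i j :=
        ψ.symm.map_rel_iff
      rw [if_neg hij]
      split_ifs with h
      · exact hadj.2 h
      · exact card_inter_eq_zero hne fun h' => h (hadj.1 h')
  have h1 : ∑ i, ∑ j, incidence (y j) i = 10 := by
    rw [Finset.sum_comm]
    simp only [sum_incidence]
    norm_num
  have h2 : ∑ i, (∑ j, incidence (y j) i) ^ 2 = 20 := by
    have h3 : ∀ i, (∑ j, incidence (y j) i) ^ 2 =
        ∑ j, ∑ k, incidence (y j) i * incidence (y k) i := fun i => by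
      rw [pow_two, Finset.sum_mul_sum]
    simp only [h3]
    rw [Finset.sum_comm, Finset.sum_congr rfl fun j _ => Finset.sum_comm]
    simp only [sum_incidence_mul_incidence]
    have h4 : ∑ j, ∑ k, ((y j).1 ∩ (y k).1).card = 20 := by
      simp only [hcard]
      decide
    exact_mod_cast h4
  have h3 : ∑ i, (∑ j, incidence (y j) i - 2) * (∑ j, incidence (y j) i - 2) = 0 := by
    have h4 : ∀ i, (∑ j, incidence (y j) i - 2) * (∑ j, incidence (y j) i - 2) =
        (∑ j, incidence (y j) i) ^ 2 - 4 * ∑ j, incidence (y j) i + 4 := fun i => by ring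
    simp only [h4, Finset.sum_sub_distrib, Finset.sum_add_distrib, ← Finset.mul_sum, h1, h2]
    norm_num
  have h4 := eq_zero_of_sum_mul_self h3
  funext i
  have h5 := congrFun h4 i
  rw [pointSum_switchSign, hsum]
  simp only [Pi.zero_apply] at h5 ⊢
  push_cast
  linarith

lemma inducesFiveCycle_iff {U : Finset (JohnsonVertex 5)} :
    InducesFiveCycle (johnsonGraph 5) U ↔ pointSum 5 (switchSign U) = 0 := by
  refine ⟨pointSum_eq_zero_of_inducesFiveCycle, fun h => ?_⟩
  obtain ⟨f, hf⟩ := exists_perm_of_pointSum_eq_zero h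
  exact inducesFiveCycle_of_perm hf

/-- The involution of the pairs of `ℤ/5` that exchanges each edge of the standard 5-cycle with the
unique diagonal disjoint from it. -/
def crossPair (i j : Fin 5) : Finset (Fin 5) :=
  if j = i + 1 then {i + 4, i + 2} else if i = j + 1 then {j + 4, j + 2}
  else if j = i + 3 then {i + 1, i + 2} else {j + 1, j + 2}

lemma card_crossPair : ∀ i j : Fin 5, i ≠ j → (crossPair i j).card = 2 := by decide

/-- `crossPair` carries the graph switched with respect to the 5-cycle to the complement of
`J(5,2)`. -/
lemma card_crossPair_inter : ∀ i j k l : Fin 5, i ≠ j → k ≠ l →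
    (({i, j} : Finset (Fin 5)) ∩ {k, l}).card ≠ 2 →
    (crossPair i j ∩ crossPair k l).card =
      if (IsCyclicPair i j ↔ IsCyclicPair k l) then 1 - (({i, j} : Finset (Fin 5)) ∩ {k, l}).card
      else (({i, j} : Finset (Fin 5)) ∩ {k, l}).card := by
  decide

/-- The switched graph is isomorphic to the complement of `J(5,2)`, so the representation of
`J(5,2)` with distances `1`, `2` gives one with the distances exchanged. -/
lemma isRepresentable_fiveCycle {U : Finset (JohnsonVertex 5)}
    (hU : InducesFiveCycle (johnsonGraph 5) U) :
    IsRepresentable (seidelSwitch (johnsonGraph 5) U) 2 1 4 0 := by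
  obtain ⟨f, hf⟩ := exists_perm_of_pointSum_eq_zero (inducesFiveCycle_iff.1 hU)
  have hex : ∀ v : JohnsonVertex 5, ∃ i j, ∃ h : f i ≠ f j, v = pairVertex (f i) (f j) h := by
    intro v
    obtain ⟨x, y, hxy, rfl⟩ := exists_eq_pairVertex v
    obtain ⟨i, rfl⟩ := f.surjective x
    obtain ⟨j, rfl⟩ := f.surjective y
    exact ⟨i, j, hxy, rfl⟩
  choose I J hIJ hv using hex
  have hne : ∀ v, I v ≠ J v := fun v h => hIJ v (congrArg f h)
  let σ : JohnsonVertex 5 → JohnsonVertex 5 := fun v =>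
    ⟨crossPair (I v) (J v), card_crossPair _ _ (hne v)⟩
  have key : IsRepresentable (seidelSwitch (johnsonGraph 5) U) 4 2 4 0 := by
    refine ⟨fun v => Sum.elim (simplexProj 4 (incidence (σ v))) Fin.elim0,
      isRepresentation_of_scalarSq fun v w hvw => ?_⟩
    have h1 := sum_simplexProj_sq (by omega : 0 < 4) (incidence (σ v) - incidence (σ w))
    simp only [map_sub, Pi.sub_apply, Finset.sum_sub_distrib, sum_incidence] at h1
    have h2 := sum_sub_incidence_sq (σ v) (σ w) 1 1
    simp only [one_mul] at h2
    rw [scalarSq_eq]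
    simp only [Pi.sub_apply, Sum.elim_inl, Finset.univ_eq_empty, Finset.sum_empty, h1, h2]
    have hcard : (v.1 ∩ w.1).card = (({I v, J v} : Finset (Fin 5)) ∩ {I w, J w}).card := by
      rw [← pair_inter_card_perm f]
      exact congrArg₂ (fun s t => (s.1 ∩ t.1).card) (hv v) (hv w)
    have hle := card_inter_le_one hvw
    have h3 : ((σ v).1 ∩ (σ w).1).card = _ :=
      card_crossPair_inter (I v) (J v) (I w) (J w) (hne v) (hne w) (by rw [← hcard]; omega)
    have hmem : ∀ v, v ∈ U ↔ IsCyclicPair (I v) (J v) := fun v => by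
      conv_lhs => rw [hv v]
      exact hf _ _ _
    rw [h3, ← hcard]
    simp only [switchSign, hmem]
    by_cases c1 : IsCyclicPair (I v) (J v) <;> by_cases c2 : IsCyclicPair (I w) (J w) <;>
      simp only [c1, c2, if_true, if_false, iff_true, iff_false, not_true] <;>
      push_cast [Nat.cast_sub hle] <;> ring
  have := key.smul (c := 1 / 2) (by norm_num)
  norm_num at this
  exact this

end FiveCycle

/-! ### Representations of the octahedron `J(4,2)` -/

section Four

/-- The index of the perfect matching of the four points to which a pair belongs. Two pairs are
adjacent in `J(4,2)` if and only if their matchings differ. -/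
def matchingClass (v : JohnsonVertex 4) : Fin 3 :=
  if (0 ∈ v.1 ↔ 1 ∈ v.1) then 0 else if (0 ∈ v.1 ↔ 2 ∈ v.1) then 1 else 2

lemma card_inter_matchingClass {v w : JohnsonVertex 4} (h : v ≠ w) :
    (v.1 ∩ w.1).card = if matchingClass v = matchingClass w then 0 else 1 := by
  revert v w
  decide

lemma isRepresentable_four_empty :
    IsRepresentable (seidelSwitch (johnsonGraph 4) ∅) 1 0 2 0 := by
  have key : IsRepresentable (seidelSwitch (johnsonGraph 4) ∅) 2 0 2 0 := by
    refine ⟨fun v => Sum.elim (simplexProj 2 (Pi.single (matchingClass v) 1)) Fin.elim0,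
      isRepresentation_of_scalarSq fun v w hvw => ?_⟩
    have h1 := sum_simplexProj_sq (by omega : 0 < 2)
      (Pi.single (matchingClass v) 1 - Pi.single (matchingClass w) 1)
    rw [map_sub] at h1
    rw [scalarSq_eq]
    simp only [Pi.sub_apply, Sum.elim_inl, Finset.univ_eq_empty, Finset.sum_empty,
      switchSign_empty] at h1 ⊢
    rw [h1, card_inter_matchingClass hvw]
    generalize matchingClass v = i
    generalize matchingClass w = j
    fin_cases i <;> fin_cases j <;> simp [Fin.sum_univ_three, Pi.single_apply] <;> norm_num
  have := key.smul (c := 1 / 2) (by norm_num)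
  norm_num at this
  exact this

/-- The pair `U` sits at the origin, the other two perfect matchings on the two null lines. -/
lemma isRepresentable_four_pair {U : Finset (JohnsonVertex 4)}
    (hU : IsNonadjacentPair (johnsonGraph 4) U) :
    IsRepresentable (seidelSwitch (johnsonGraph 4) U) 1 0 1 1 := by
  obtain ⟨u, u', huu', hnadj, hmem⟩ := hU
  have hclass : ∀ v, v ∈ U ↔ matchingClass v = matchingClass u := by
    have h0 : ∀ u u' v : JohnsonVertex 4, u ≠ u' → (u.1 ∩ u'.1).card ≠ 1 →
        ((v = u ∨ v = u') ↔ matchingClass v = matchingClass u) := by decide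
    exact fun v => (hmem v).trans (h0 u u' v huu' hnadj)
  refine ⟨fun v => Sum.elim
    (fun _ => if matchingClass v = matchingClass u then 0
      else if matchingClass v = matchingClass u + 1 then 1 / 2 else -1 / 2)
    (fun _ => if matchingClass v = matchingClass u then 0 else 1 / 2),
    isRepresentation_of_scalarSq fun v w hvw => ?_⟩
  rw [scalarSq_eq, card_inter_matchingClass hvw]
  simp only [switchSign, hclass, Pi.sub_apply, Sum.elim_inl, Sum.elim_inr, Finset.univ_unique,
    Finset.sum_singleton]
  generalize matchingClass v = i
  generalize matchingClass w = j
  generalize matchingClass u = k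
  fin_cases i <;> fin_cases j <;> fin_cases k <;> simp <;> norm_num

lemma isRegularTriangle_range {c : ℝ} (hc : 0 < c)
    {φ : JohnsonVertex 4 → PseudoEuclidean 2 0}
    (h : IsRepresentation (seidelSwitch (johnsonGraph 4) ∅) c 0 φ) :
    IsRegularTriangle (Set.range φ) := by
  have hsame : ∀ v w, matchingClass v = matchingClass w → φ v = φ w := by
    intro v w hvw
    by_cases hne : v = w
    · rw [hne]
    have h1 := h.scalarSq_eq v w
    rw [card_inter_matchingClass hne, if_pos hvw, if_neg hne, switchSign_empty, switchSign_empty,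
      scalarSq_eq] at h1
    have h2 : ∑ i, (φ v - φ w) (Sum.inl i) * (φ v - φ w) (Sum.inl i) = 0 := by
      simp only [← pow_two]
      rw [Finset.univ_eq_empty (α := Fin 0), Finset.sum_empty] at h1
      linarith
    have h3 := eq_zero_of_sum_mul_self (x := fun i => (φ v - φ w) (Sum.inl i)) h2
    funext s
    rcases s with i | i
    · exact sub_eq_zero.1 (congrFun h3 i)
    · exact i.elim0
  have hdiff : ∀ v w, matchingClass v ≠ matchingClass w → scalarSq (φ v - φ w) = c := by
    intro v w hvw
    have hne : v ≠ w := fun h => hvw (congrArg _ h)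
    rw [h.scalarSq_eq v w, card_inter_matchingClass hne, if_neg hvw, if_neg hne, switchSign_empty,
      switchSign_empty]
    push_cast
    ring
  have hdiff' : ∀ v w, matchingClass v ≠ matchingClass w → φ v ≠ φ w := by
    intro v w hvw heq
    have h1 := hdiff v w hvw
    rw [heq, sub_self] at h1
    have h2 : scalarSq (0 : PseudoEuclidean 2 0) = 0 := by simp [scalarSq_eq]
    linarith
  refine ⟨?_, c, hc, ?_⟩
  · let v₀ : JohnsonVertex 4 := pairVertex 0 1 (by decide)
    let v₁ : JohnsonVertex 4 := pairVertex 0 2 (by decide)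
    let v₂ : JohnsonVertex 4 := pairVertex 0 3 (by decide)
    refine Set.ncard_eq_three.2 ⟨φ v₀, φ v₁, φ v₂, hdiff' _ _ (by decide), hdiff' _ _ (by decide),
      hdiff' _ _ (by decide), ?_⟩
    ext x
    simp only [Set.mem_range, Set.mem_insert_iff, Set.mem_singleton_iff]
    constructor
    · rintro ⟨v, rfl⟩
      have h3 : ∀ v : JohnsonVertex 4, matchingClass v = matchingClass v₀ ∨
          matchingClass v = matchingClass v₁ ∨ matchingClass v = matchingClass v₂ := by decide
      exact (h3 v).imp (hsame _ _) (Or.imp (hsame _ _) (hsame _ _))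
    · rintro (rfl | rfl | rfl)
      exacts [⟨_, rfl⟩, ⟨_, rfl⟩, ⟨_, rfl⟩]
  · rintro _ ⟨v, rfl⟩ _ ⟨w, rfl⟩ hne
    exact hdiff v w fun heq => hne (hsame v w heq)

end Four

/-! ### Classification of the optimal representations -/

section Classification

variable {m : ℕ} {U : Finset (JohnsonVertex m)} {a b : ℝ} {p q : ℕ}

/-- The induced form on the decomposition into the kernel of the incidence map and the range of its
transpose. -/
lemma distanceForm_add_edgeSum {k k' : JohnsonVertex m → ℝ} (hk : pointSum m k = 0)
    (hk' : pointSum m k' = 0) (w w' : Fin m → ℝ) :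
    distanceForm a b (k + edgeSum m w) (k' + edgeSum m w') =
      (2 * a - b) * ∑ v, k v * k' v +
      ((2 * a - b) * (m - 2) + (b - a) * (m - 2) ^ 2) * ∑ i, w i * w' i +
      ((2 * a - b) + (b - a) * (3 * m - 4) - (b - a) / 2 * (m - 1) ^ 2) *
        ((∑ i, w i) * ∑ i, w' i) := by
  have e1 : ∑ v, (k + edgeSum m w) v * (k' + edgeSum m w') v =
      ∑ v, k v * k' v + ((m - 2) * ∑ i, w i * w' i + (∑ i, w i) * ∑ i, w' i) := by
    have h1 := sum_edgeSum_mul w k'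
    have h2 := sum_edgeSum_mul w' k
    have h3 := sum_edgeSum_mul w (edgeSum m w')
    simp only [pointSum_edgeSum, hk, hk', Pi.zero_apply, mul_zero, Finset.sum_const_zero, mul_add,
      Finset.sum_add_distrib, ← Finset.sum_mul] at h1 h2 h3
    have h4 : ∀ v, (k + edgeSum m w) v * (k' + edgeSum m w') v =
        k v * k' v + edgeSum m w v * k' v + edgeSum m w' v * k v +
          edgeSum m w v * edgeSum m w' v := fun v => by
      simp only [Pi.add_apply]
      ring
    have h5 : ∑ i, w i * (((m : ℝ) - 2) * w' i) = (m - 2) * ∑ i, w i * w' i := by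
      rw [Finset.mul_sum]
      exact Finset.sum_congr rfl fun _ _ => by ring
    simp only [h4, Finset.sum_add_distrib, h1, h2, h3, h5]
    ring
  have e2 : ∑ i, pointSum m (k + edgeSum m w) i * pointSum m (k' + edgeSum m w') i =
      (m - 2) ^ 2 * ∑ i, w i * w' i + (3 * m - 4) * ((∑ i, w i) * ∑ i, w' i) := by
    have h4 : ∀ i, pointSum m (k + edgeSum m w) i * pointSum m (k' + edgeSum m w') i =
        (m - 2) ^ 2 * (w i * w' i) + (m - 2) * (∑ j, w' j) * w i + (m - 2) * (∑ j, w j) * w' i +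
          (∑ j, w j) * ∑ j, w' j := fun i => by
      rw [map_add, map_add, hk, hk', zero_add, zero_add, pointSum_edgeSum, pointSum_edgeSum]
      ring
    simp only [h4, Finset.sum_add_distrib, ← Finset.mul_sum, Finset.sum_const, Finset.card_univ,
      Fintype.card_fin, nsmul_eq_mul]
    ring
  have e3 : ∀ (k : JohnsonVertex m → ℝ) (w : Fin m → ℝ), pointSum m k = 0 →
      ∑ v, (k + edgeSum m w) v = (m - 1) * ∑ i, w i := by
    intro k w hk
    simp only [Pi.add_apply, Finset.sum_add_distrib, sum_edgeSum,
      sum_eq_zero_of_pointSum_eq_zero hk, zero_add]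
  rw [distanceForm, e1, e2, e3 k w hk, e3 k' w' hk']
  ring

lemma signedSum_edgeSum (w : Fin m → ℝ) :
    signedSum U (edgeSum m w) = ∑ i, w i * pointSum m (switchSign U) i := by
  rw [signedSum_apply, ← sum_edgeSum_mul]
  exact Finset.sum_congr rfl fun _ _ => by ring

/-- For `b = 2a` and `m ≠ 8` no switching set other than the constant and star ones admits a
representation in dimension below `m`. -/
lemma IsRepresentation.eq_star_or_const (hm : 4 ≤ m) (hm8 : m ≠ 8) (ha : 0 < a)
    {φ : JohnsonVertex m → PseudoEuclidean p q}
    (h : IsRepresentation (seidelSwitch (johnsonGraph m) U) a (2 * a) φ) (hpq : p + q < m) :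
    ((U = ∅ ∨ U = Finset.univ) ∧ m - 1 ≤ p) ∨
    ∃ i, (U = pointStar i ∨ U = (pointStar i)ᶜ) ∧ (m ≤ 9 → m - 1 ≤ p) ∧ m - 2 ≤ p ∧
      (11 ≤ m → 1 ≤ q) := by
  rcases switchingSet_trichotomy hm U with hU | ⟨hU, hl⟩ | ⟨i, hU, hl⟩
  · have := h.le_add_of_liftable ha hU hm8
    omega
  · exact Or.inl ⟨hU, h.sub_one_le_pos_of_sum_eq_zero ha hl⟩
  · exact Or.inr ⟨i, hU, h.sub_one_le_pos_of_star ha hl, h.sub_two_le_pos_of_star ha hl,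
      h.one_le_neg_of_star ha hl⟩

/-- For `m = 8` the form `|y|² - (∑ y)² / 8` is positive semidefinite with radical spanned by the
all-one vector, so every switching set leaves seven positive dimensions. -/
lemma IsRepresentation.seven_le {U : Finset (JohnsonVertex 8)} (ha : 0 < a)
    {φ : JohnsonVertex 8 → PseudoEuclidean p q}
    (h : IsRepresentation (seidelSwitch (johnsonGraph 8) U) a (2 * a) φ) : 7 ≤ p := by
  rcases switchingSet_trichotomy (by omega) U with hU | ⟨hU, hl⟩ | ⟨i, hU, hl⟩
  · exact h.sub_one_le_pos_of_sum_eq_zero ha fun y _ => hU y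
  · exact h.sub_one_le_pos_of_sum_eq_zero ha hl
  · exact h.sub_one_le_pos_of_star ha hl (by omega)

lemma ne_univ_of_two_mul_card_le (hm : 2 ≤ m) (hU : 2 * U.card ≤ Fintype.card (JohnsonVertex m)) :
    U ≠ Finset.univ := by
  rintro rfl
  have h1 := two_mul_card_johnsonVertex m
  have h2 : (2 : ℝ) ≤ m := by exact_mod_cast hm
  have h3 : (0 : ℝ) < Fintype.card (JohnsonVertex m) := by nlinarith
  have h4 : 0 < Fintype.card (JohnsonVertex m) := by exact_mod_cast h3
  rw [Finset.card_univ] at hU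
  omega

lemma ne_compl_pointStar_of_two_mul_card_le (hm : 5 ≤ m)
    (hU : 2 * U.card ≤ Fintype.card (JohnsonVertex m)) (i : Fin m) : U ≠ (pointStar i)ᶜ := by
  rintro rfl
  rw [Finset.card_compl, card_pointStar] at hU
  have h1 := two_mul_card_johnsonVertex m
  have h2 : (5 : ℝ) ≤ m := by exact_mod_cast hm
  have h3 : (Fintype.card (JohnsonVertex m) : ℝ) ≤ 2 * ((m - 1 : ℕ) : ℝ) := by
    exact_mod_cast (by omega : Fintype.card (JohnsonVertex m) ≤ 2 * (m - 1))
  rw [Nat.cast_sub (by omega), Nat.cast_one] at h3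
  nlinarith

lemma lt_card_johnsonVertex (hm : 6 ≤ m) :
    m - 1 < Fintype.card (JohnsonVertex m) - (m + 1) := by
  have h1 := two_mul_card_johnsonVertex m
  have h2 : (6 : ℝ) ≤ m := by exact_mod_cast hm
  have h3 : ((2 * m : ℕ) : ℝ) < Fintype.card (JohnsonVertex m) := by
    push_cast
    nlinarith
  have h4 : 2 * m < Fintype.card (JohnsonVertex m) := by exact_mod_cast h3
  omega

/-- For `m ≥ 6` a representation in dimension below `m` has `b = 2a`. -/
lemma IsRepresentation.eq_two_mul (hm : 6 ≤ m) {φ : JohnsonVertex m → PseudoEuclidean p q}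
    (h : IsRepresentation (seidelSwitch (johnsonGraph m) U) a b φ) (hpq : p + q < m) :
    b = 2 * a := by
  by_contra hab
  have h1 := h.card_le_add hab
  have h2 := lt_card_johnsonVertex hm
  omega

lemma agreeUpToScaling_one_two (ha : 0 < a) (p q : ℕ) :
    AgreeUpToScaling 1 2 p q a (2 * a) p q :=
  ⟨a, by ring, by ring, Or.inl ⟨ha, rfl, rfl⟩⟩

lemma card_johnsonVertex_five : Fintype.card (JohnsonVertex 5) = 10 := by
  have h := two_mul_card_johnsonVertex 5
  have h1 : (Fintype.card (JohnsonVertex 5) : ℝ) = ((10 : ℕ) : ℝ) := by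
    push_cast at h ⊢
    linarith
  exact_mod_cast h1

lemma card_johnsonVertex_four : Fintype.card (JohnsonVertex 4) = 6 := by
  have h := two_mul_card_johnsonVertex 4
  have h1 : (Fintype.card (JohnsonVertex 4) : ℝ) = ((6 : ℕ) : ℝ) := by
    push_cast at h ⊢
    linarith
  exact_mod_cast h1

/-- The projection, along `edgeSum m w`, of the kernel of the incidence map to the vectors
orthogonal to the sign vector of `U`. -/
noncomputable def kernelShift (U : Finset (JohnsonVertex m)) (w : Fin m → ℝ) :
    LinearMap.ker (pointSum m) →ₗ[ℝ] (JohnsonVertex m → ℝ) :=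
  (LinearMap.ker (pointSum m)).subtype -
    ((signedSum U).comp (LinearMap.ker (pointSum m)).subtype).smulRight
      ((signedSum U (edgeSum m w))⁻¹ • edgeSum m w)

lemma kernelShift_apply (w : Fin m → ℝ) (x : LinearMap.ker (pointSum m)) :
    kernelShift U w x = x + edgeSum m
      ((-(signedSum U x * (signedSum U (edgeSum m w))⁻¹)) • w) := by
  simp only [kernelShift, LinearMap.sub_apply, LinearMap.smulRight_apply, LinearMap.comp_apply,
    Submodule.subtype_apply, smul_smul, neg_smul]
  rw [map_neg, map_smul, ← sub_eq_add_neg]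

lemma signedSum_kernelShift {w : Fin m → ℝ} (hw : signedSum U (edgeSum m w) ≠ 0)
    (x : LinearMap.ker (pointSum m)) : signedSum U (kernelShift U w x) = 0 := by
  rw [kernelShift_apply, map_smul, map_add, map_smul, smul_eq_mul]
  field_simp
  ring

lemma sub_finrank_le_finrank_ker_pi {F : Type*} [AddCommGroup F] [Module ℝ F]
    [FiniteDimensional ℝ F] (f : (Fin m → ℝ) →ₗ[ℝ] F) :
    m - Module.finrank ℝ F ≤ Module.finrank ℝ (LinearMap.ker f) := by
  simpa using finrank_sub_le_finrank_ker f

/-- For `m = 5` and `b ≠ 2a` the other exceptional case is `a = 2b`, with `U` a 5-cycle: here the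
Seidel matrix of `J(5,2)` acts as the scalar `-3` on the whole range of `edgeSum`. -/
lemma IsRepresentation.five_of_ne {U : Finset (JohnsonVertex 5)} (hlt : a < b) (hab : b ≠ 2 * a)
    {φ : JohnsonVertex 5 → PseudoEuclidean p q}
    (h : IsRepresentation (seidelSwitch (johnsonGraph 5) U) a b φ) (hpq : p + q ≤ 4) :
    InducesFiveCycle (johnsonGraph 5) U ∧ AgreeUpToScaling 2 1 4 0 a b p q := by
  have hdimK := card_sub_le_finrank_signedKernel (U := U)
  have hdimW := card_sub_le_finrank_ker_pointSum (m := 5)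
  rw [card_johnsonVertex_five] at hdimK hdimW
  have hform : ∀ {k k' : JohnsonVertex 5 → ℝ}, pointSum 5 k = 0 → pointSum 5 k' = 0 →
      ∀ w w' : Fin 5 → ℝ, distanceForm a b (k + edgeSum 5 w) (k' + edgeSum 5 w') =
        (2 * a - b) * ∑ v, k v * k' v + (2 * b - a) *
          (3 * ∑ i, w i * w' i + (∑ i, w i) * ∑ i, w' i) := by
    intro k k' hk hk' w w'
    rw [distanceForm_add_edgeSum hk hk']
    push_cast
    ring
  have hab' : 2 * a - b ≠ 0 := fun h0 => hab (by linarith)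
  have hba : a = 2 * b := by
    by_contra hba
    have hba' : 2 * b - a ≠ 0 := fun h0 => hba (by linarith)
    let F := LinearMap.ker ((signedSum U).comp (edgeSum 5))
    have hF := sub_finrank_le_finrank_ker_pi ((signedSum U).comp (edgeSum 5))
    have h1 := h.finrank_le_add
      ((signedKernel U).subtype.coprod ((edgeSum 5).comp F.subtype)) ?_ ?_
    · rw [Module.finrank_prod] at h1
      rw [Module.finrank_self] at hF
      have : Module.finrank ℝ F = Module.finrank ℝ
        (LinearMap.ker ((signedSum U).comp (edgeSum 5))) := rfl
      omega
    · rintro ⟨k, w⟩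
      have h2 : signedSum U (edgeSum 5 w) = 0 := w.2
      simp [(mem_signedKernel.1 k.2).2, h2]
    · rintro ⟨k, w⟩ hkw
      have hk := (mem_signedKernel.1 k.2).1
      have h2 := hkw (k, 0)
      have h3 := hkw (0, w)
      simp only [LinearMap.coprod_apply, Submodule.subtype_apply, LinearMap.comp_apply] at h2 h3
      rw [hform hk hk] at h2
      rw [hform hk (by simp)] at h3
      simp [hab', hba'] at h2 h3
      have h4 : (k : JohnsonVertex 5 → ℝ) = 0 := eq_zero_of_sum_mul_self h2
      have h5 : (w : Fin 5 → ℝ) = 0 := by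
        apply eq_zero_of_sum_mul_self
        have h6 : 0 ≤ ∑ i, (w : Fin 5 → ℝ) i * (w : Fin 5 → ℝ) i :=
          Finset.sum_nonneg fun _ _ => mul_self_nonneg _
        have h7 := mul_self_nonneg (∑ i, (w : Fin 5 → ℝ) i)
        linarith
      exact Prod.ext (Subtype.ext h4) (Subtype.ext h5)
  subst hba
  have hb : b < 0 := by linarith
  refine ⟨inducesFiveCycle_iff.2 ?_, ?_⟩
  · by_contra hne
    have hw : signedSum U (edgeSum 5 (pointSum 5 (switchSign U))) ≠ 0 := by
      rw [signedSum_edgeSum]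
      exact (sum_mul_self_pos hne).ne'
    have h1 := h.finrank_le_add (kernelShift U (pointSum 5 (switchSign U)))
      (signedSum_kernelShift hw) ?_
    · omega
    · intro k hk
      have h2 := hk k
      rw [kernelShift_apply, hform k.2 k.2, mul_eq_zero.2 (Or.inl (by ring : 2 * b - 2 * b = 0)),
        add_zero] at h2
      exact Subtype.ext (eq_zero_of_sum_mul_self ((mul_eq_zero.1 h2).resolve_left hab'))
  · have h1 := h.finrank_le_neg (signedKernel U).subtype (fun e => (mem_signedKernel.1 e.2).2) ?_
    · exact ⟨b, by ring, by ring, Or.inr ⟨hb, by omega, by omega⟩⟩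
    · intro e he
      rw [Submodule.subtype_apply, distanceForm_of_pointSum_eq_zero (mem_signedKernel.1 e.2).1]
      refine mul_neg_of_neg_of_pos (by linarith) (sum_mul_self_pos ?_)
      simpa using he

/-- In `J(4,2)` a set `U` of at most three pairs that covers all points equally often is empty or a
perfect matching. -/
lemma eq_empty_or_isNonadjacentPair {U : Finset (JohnsonVertex 4)} (hcard : 2 * U.card ≤ 6)
    (hU : ∀ i j, pointSum 4 (switchSign U) i = pointSum 4 (switchSign U) j) :
    U = ∅ ∨ (IsNonadjacentPair (johnsonGraph 4) U ∧ ∀ i, pointSum 4 (switchSign U) i = 1) := by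
  have hdeg : ∀ i, ∑ v ∈ U, incidence v i = ((U.filter fun v => i ∈ v.1).card : ℝ) := by
    intro i
    simp only [incidence]
    rw [Finset.sum_boole]
  have hconst : ∀ i, (U.filter fun v => i ∈ v.1).card = (U.filter fun v => 0 ∈ v.1).card := by
    intro i
    have h1 := hU i 0
    rw [pointSum_switchSign, pointSum_switchSign, hdeg, hdeg] at h1
    have h2 : ((U.filter fun v => i ∈ v.1).card : ℝ) = (U.filter fun v => 0 ∈ v.1).card := by
      linarith
    exact_mod_cast h2
  set δ := (U.filter fun v => 0 ∈ v.1).card with hδ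
  have htot : 4 * δ = 2 * U.card := by
    have h1 : ∑ i, ∑ v ∈ U, incidence v i = 2 * U.card := by
      rw [Finset.sum_comm]
      simp only [sum_incidence, Finset.sum_const, nsmul_eq_mul, mul_comm]
    simp only [hdeg, hconst, Finset.sum_const, Finset.card_univ, Fintype.card_fin,
      nsmul_eq_mul] at h1
    exact_mod_cast h1
  by_cases h0 : δ = 0
  · left
    rw [← Finset.card_eq_zero]
    omega
  right
  have h1 : δ = 1 := by omega
  obtain ⟨u, v, huv, rfl⟩ := Finset.card_eq_two.1 (by omega : U.card = 2)
  refine ⟨⟨u, v, huv, fun hadj => ?_, by simp⟩, fun i => ?_⟩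
  · obtain ⟨i, hi⟩ := Finset.card_pos.1
      (by rw [johnsonGraph_adj.1 hadj]; norm_num : 0 < (u.1 ∩ v.1).card)
    rw [Finset.mem_inter] at hi
    have h2 := hconst i
    rw [Finset.filter_true_of_mem (by simp [hi.1, hi.2]), Finset.card_pair huv] at h2
    omega
  · rw [pointSum_switchSign, hdeg, hconst, h1]
    norm_num

/-- For `m = 4` two-dimensional representations have `b = 0`, the case in which the form vanishes on
`edgeSum` of the weights with sum zero. -/
lemma IsRepresentation.four {U : Finset (JohnsonVertex 4)}
    (hcard : 2 * U.card ≤ Fintype.card (JohnsonVertex 4)) (hlt : a < b)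
    {φ : JohnsonVertex 4 → PseudoEuclidean p q}
    (h : IsRepresentation (seidelSwitch (johnsonGraph 4) U) a b φ) (hpq : p + q ≤ 2) :
    (U = ∅ ∧ AgreeUpToScaling 1 0 2 0 a b p q) ∨
      (IsNonadjacentPair (johnsonGraph 4) U ∧ AgreeUpToScaling 1 0 1 1 a b p q) := by
  have hab : b ≠ 2 * a := by
    rintro rfl
    rcases h.eq_star_or_const (by omega) (by omega) (by linarith) (by omega) with
      ⟨-, h1⟩ | ⟨i, -, h1, -⟩
    · omega
    · have := h1 (by omega)
      omega
  have hdimK := card_sub_le_finrank_signedKernel (U := U)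
  have hdimW := card_sub_le_finrank_ker_pointSum (m := 4)
  rw [card_johnsonVertex_four] at hdimK hdimW hcard
  have hform : ∀ {k k' : JohnsonVertex 4 → ℝ}, pointSum 4 k = 0 → pointSum 4 k' = 0 →
      ∀ w w' : Fin 4 → ℝ, distanceForm a b (k + edgeSum 4 w) (k' + edgeSum 4 w') =
        (2 * a - b) * ∑ v, k v * k' v + 2 * b * ∑ i, w i * w' i +
          (5 * b - 3 * a) / 2 * ((∑ i, w i) * ∑ i, w' i) := by
    intro k k' hk hk' w w'
    rw [distanceForm_add_edgeSum hk hk']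
    push_cast
    ring
  have hab' : 2 * a - b ≠ 0 := fun h0 => hab (by linarith)
  have hb : b = 0 := by
    by_contra hb
    let f := (coordSum 4).prod ((signedSum U).comp (edgeSum 4))
    have hF := sub_finrank_le_finrank_ker_pi f
    have hmem : ∀ w : LinearMap.ker f, ∑ i, (w : Fin 4 → ℝ) i = 0 ∧
        signedSum U (edgeSum 4 w) = 0 := by
      rintro ⟨w, hw⟩
      simpa [f, coordSum_apply] using hw
    have h1 := h.finrank_le_add
      ((signedKernel U).subtype.coprod ((edgeSum 4).comp (LinearMap.ker f).subtype)) ?_ ?_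
    · rw [Module.finrank_prod] at h1
      rw [Module.finrank_prod, Module.finrank_self] at hF
      omega
    · rintro ⟨k, w⟩
      simp [(mem_signedKernel.1 k.2).2, (hmem w).2]
    · rintro ⟨k, w⟩ hkw
      have hk := (mem_signedKernel.1 k.2).1
      have h2 := hkw (k, 0)
      have h3 := hkw (0, w)
      simp only [LinearMap.coprod_apply, Submodule.subtype_apply, LinearMap.comp_apply] at h2 h3
      rw [hform hk hk, (hmem w).1] at h2
      rw [hform hk (by simp), (hmem w).1] at h3
      simp [hab', hb] at h2 h3
      exact Prod.ext (Subtype.ext (eq_zero_of_sum_mul_self h2))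
        (Subtype.ext (eq_zero_of_sum_mul_self h3))
  subst hb
  have horth : ∀ w : Fin 4 → ℝ, ∑ i, w i = 0 → signedSum U (edgeSum 4 w) = 0 := by
    intro w hw0
    by_contra hw
    -- shift the all-one vector along `edgeSum 4 w` as well
    let c := signedSum U (edgeSum 4 1) * (signedSum U (edgeSum 4 w))⁻¹
    have h1 := h.finrank_le_add ((kernelShift U w).coprod
      (LinearMap.toSpanSingleton ℝ _ (edgeSum 4 (1 - c • w)))) ?_ ?_
    · rw [Module.finrank_prod, Module.finrank_self] at h1
      omega
    · rintro ⟨k, r⟩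
      rw [LinearMap.coprod_apply, map_add, signedSum_kernelShift hw,
        LinearMap.toSpanSingleton_apply, map_smul, map_sub, map_sub, map_smul, map_smul]
      simp only [c, smul_eq_mul]
      field_simp
      simp
    · have hg : ∀ (k : LinearMap.ker (pointSum 4)) (r : ℝ), ∃ w' : Fin 4 → ℝ,
          ∑ i, w' i = 4 * r ∧ (kernelShift U w).coprod
            (LinearMap.toSpanSingleton ℝ _ (edgeSum 4 (1 - c • w))) (k, r) =
              k + edgeSum 4 w' := by
        intro k r
        refine ⟨(-(signedSum U k * (signedSum U (edgeSum 4 w))⁻¹)) • w + r • (1 - c • w), ?_, ?_⟩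
        · simp only [Pi.add_apply, Pi.smul_apply, Pi.sub_apply, smul_eq_mul, Pi.one_apply,
            Finset.sum_add_distrib, ← Finset.mul_sum, Finset.sum_sub_distrib, hw0]
          simp [mul_comm]
        · rw [LinearMap.coprod_apply, kernelShift_apply, LinearMap.toSpanSingleton_apply,
            map_add (edgeSum 4), map_smul (edgeSum 4) r, add_assoc]
      rintro ⟨k, r⟩ hkr
      have h2 := hkr (k, 0)
      have h3 := hkr (0, r)
      obtain ⟨w₁, hs₁, e₁⟩ := hg k r
      obtain ⟨w₂, hs₂, e₂⟩ := hg k 0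
      obtain ⟨w₃, hs₃, e₃⟩ := hg 0 r
      rw [e₁, e₂, hform k.2 k.2, hs₁, hs₂] at h2
      rw [e₁, e₃, hform k.2 (by simp), hs₁, hs₃] at h3
      have ha : a ≠ 0 := hlt.ne
      simp [ha] at h2 h3
      exact Prod.ext (Subtype.ext (eq_zero_of_sum_mul_self h2)) h3
  have hconst : ∀ i j, pointSum 4 (switchSign U) i = pointSum 4 (switchSign U) j := by
    intro i j
    have h1 := horth (Pi.single i 1 - Pi.single j 1) (by simp)
    rw [signedSum_edgeSum] at h1
    simp [sub_mul, Finset.sum_sub_distrib, Pi.single_apply] at h1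
    linarith
  rcases eq_empty_or_isNonadjacentPair hcard hconst with rfl | ⟨hpair, hone⟩
  · left
    have h1 := h.finrank_le_neg (LinearMap.ker (pointSum 4)).subtype ?_ ?_
    · exact ⟨rfl, a, by ring, by ring, Or.inr ⟨hlt, by omega, by omega⟩⟩
    · intro e
      rw [signedSum_apply]
      simpa [switchSign_empty] using sum_eq_zero_of_pointSum_eq_zero e.2
    · intro e he
      rw [Submodule.subtype_apply, distanceForm_of_pointSum_eq_zero e.2]
      refine mul_neg_of_neg_of_pos (by linarith) (sum_mul_self_pos ?_)
      simpa using he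
  · right
    have h1 := h.finrank_le_neg (signedKernel U).subtype (fun e => (mem_signedKernel.1 e.2).2) ?_
    swap
    · intro e he
      rw [Submodule.subtype_apply, distanceForm_of_pointSum_eq_zero (mem_signedKernel.1 e.2).1]
      refine mul_neg_of_neg_of_pos (by linarith) (sum_mul_self_pos ?_)
      simpa using he
    -- the vector that is `4` on `U` and `2` elsewhere is orthogonal to the sign vector
    let x : JohnsonVertex 4 → ℝ := fun v => 3 - switchSign U v
    have hsumu : ∑ v, switchSign U v = 2 := by
      have h2 := sum_pointSum (switchSign U)
      simp only [hone] at h2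
      simp at h2
      linarith
    have hcard6 : ((Finset.univ : Finset (JohnsonVertex 4)).card : ℝ) = 6 := by
      rw [Finset.card_univ, card_johnsonVertex_four]
      norm_num
    have hxsum : ∑ v, x v = 16 := by
      simp only [x, Finset.sum_sub_distrib, Finset.sum_const, nsmul_eq_mul, hcard6, hsumu]
      norm_num
    have hxsigned : signedSum U x = 0 := by
      have h2 : ∀ v, switchSign U v * x v = 3 * switchSign U v - 1 := fun v => by
        have := switchSign_mul_self U v
        simp only [x]
        linear_combination -this
      simp only [signedSum_apply, h2, Finset.sum_sub_distrib, ← Finset.mul_sum, hsumu,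
        Finset.sum_const, nsmul_eq_mul, hcard6]
      norm_num
    have hxsq : ∑ v, x v * x v = 48 := by
      have h2 : ∀ v, x v * x v = 10 - 6 * switchSign U v := fun v => by
        have := switchSign_mul_self U v
        simp only [x]
        linear_combination this
      simp only [h2, Finset.sum_sub_distrib, ← Finset.mul_sum, hsumu,
        Finset.sum_const, nsmul_eq_mul, hcard6]
      norm_num
    have hxpoint : ∀ i, pointSum 4 x i = 8 := by
      intro i
      have h2 := hone i
      rw [pointSum_apply] at h2
      simp only [pointSum_apply, x, sub_mul, Finset.sum_sub_distrib, ← Finset.mul_sum,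
        sum_vertex_incidence, h2]
      norm_num
    have h2 := h.finrank_le_pos (LinearMap.toSpanSingleton ℝ _ x) ?_ ?_
    · rw [Module.finrank_self] at h2
      exact ⟨hpair, a, by ring, by ring, Or.inr ⟨hlt, by omega, by omega⟩⟩
    · intro r
      rw [LinearMap.toSpanSingleton_apply, map_smul, hxsigned, smul_zero]
    · intro r hr
      have h3 : distanceForm a 0 (r • x) (r • x) = r ^ 2 * distanceForm a 0 x x := by
        simp only [distanceForm, map_smul, Pi.smul_apply, smul_eq_mul]
        have e1 : ∀ s : ℝ, r * s * (r * s) = r ^ 2 * (s * s) := fun s => by ring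
        simp only [e1, ← Finset.mul_sum]
        ring
      rw [LinearMap.toSpanSingleton_apply, h3, distanceForm, hxsum, hxsq]
      simp only [hxpoint]
      have : 0 < r ^ 2 := by positivity
      refine mul_pos this ?_
      simp
      linarith

end Classification

/-! ### The optimal representations for each `m` -/

lemma classification_four :
    IsMinDimensionality (johnsonGraph 4) 2 ∧
      AttainedExactlyBy (johnsonGraph 4) 2 (fun U a b p q =>
        (U = ∅ ∧ AgreeUpToScaling 1 0 2 0 a b p q) ∨
        (IsNonadjacentPair (johnsonGraph 4) U ∧ AgreeUpToScaling 1 0 1 1 a b p q)) := by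
  refine isMinDimensionality_and_attainedExactlyBy ?_ ?_
    ⟨∅, 1, 0, 2, 0, one_ne_zero, Or.inl ⟨rfl, AgreeUpToScaling.refl _ _ _ _⟩⟩ ?_ ?_
  · exact fun U a b p q h => h.imp (And.imp_right AgreeUpToScaling.neg)
      (And.imp_right AgreeUpToScaling.neg)
  · rintro U a b p q (⟨-, h⟩ | ⟨-, h⟩) <;> exact h.add_eq
  · rintro U a b p q (⟨rfl, h⟩ | ⟨hU, h⟩)
    · exact isRepresentable_four_empty.of_agreeUpToScaling h
    · exact (isRepresentable_four_pair hU).of_agreeUpToScaling h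
  · rintro U hU a b hab p q hpq ⟨φ, h⟩
    exact h.four hU hab hpq

lemma classification_five :
    IsMinDimensionality (johnsonGraph 5) 4 ∧
      AttainedExactlyBy (johnsonGraph 5) 4 (fun U a b p q =>
        ((U = ∅ ∨ IsDelsarteClique (johnsonGraph 5) U) ∧ AgreeUpToScaling 1 2 4 0 a b p q) ∨
        (InducesFiveCycle (johnsonGraph 5) U ∧ AgreeUpToScaling 2 1 4 0 a b p q)) := by
  refine isMinDimensionality_and_attainedExactlyBy ?_ ?_
    ⟨∅, 1, 2, 4, 0, by norm_num, Or.inl ⟨Or.inl rfl, AgreeUpToScaling.refl _ _ _ _⟩⟩ ?_ ?_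
  · exact fun U a b p q h => h.imp (And.imp_right AgreeUpToScaling.neg)
      (And.imp_right AgreeUpToScaling.neg)
  · rintro U a b p q (⟨-, h⟩ | ⟨-, h⟩) <;> exact h.add_eq
  · rintro U a b p q (⟨rfl | hU, h⟩ | ⟨hU, h⟩)
    · exact (isRepresentable_empty (by omega)).of_agreeUpToScaling h
    · obtain ⟨i, rfl⟩ := (isDelsarteClique_iff (by omega)).1 hU
      exact (isRepresentable_star_of_lt_ten (k := 3) (by omega) (by omega) i).of_agreeUpToScaling h
    · exact (isRepresentable_fiveCycle hU).of_agreeUpToScaling h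
  · rintro U hU a b hab p q hpq ⟨φ, h⟩
    by_cases hb : b = 2 * a
    · subst hb
      have ha : 0 < a := by linarith
      rcases h.eq_star_or_const (by omega) (by omega) ha (by omega) with
        ⟨hU' | hU', hp⟩ | ⟨i, hU' | hU', hp, -⟩
      · obtain ⟨rfl, rfl⟩ : p = 4 ∧ q = 0 := by omega
        exact Or.inl ⟨Or.inl hU', agreeUpToScaling_one_two ha _ _⟩
      · exact absurd hU' (ne_univ_of_two_mul_card_le (by omega) hU)
      · have hp' := hp (by omega)
        obtain ⟨rfl, rfl⟩ : p = 4 ∧ q = 0 := by omega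
        exact Or.inl ⟨Or.inr ((isDelsarteClique_iff (by omega)).2 ⟨i, hU'⟩),
          agreeUpToScaling_one_two ha _ _⟩
      · exact absurd hU' (ne_compl_pointStar_of_two_mul_card_le (by omega) hU i)
    · exact Or.inr (h.five_of_ne hab hb hpq)

lemma classification_six_seven_nine {m : ℕ} (hm : m = 6 ∨ m = 7 ∨ m = 9) :
    IsMinDimensionality (johnsonGraph m) (m - 1) ∧
      AttainedExactlyBy (johnsonGraph m) (m - 1) (fun U a b p q =>
        (U = ∅ ∨ IsDelsarteClique (johnsonGraph m) U) ∧
          AgreeUpToScaling 1 2 (m - 1) 0 a b p q) := by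
  refine isMinDimensionality_and_attainedExactlyBy ?_ ?_
    ⟨∅, 1, 2, m - 1, 0, by norm_num, Or.inl rfl, AgreeUpToScaling.refl _ _ _ _⟩ ?_ ?_
  · exact fun U a b p q h => h.imp_right AgreeUpToScaling.neg
  · rintro U a b p q ⟨-, h⟩
    exact h.add_eq
  · rintro U a b p q ⟨rfl | hU, h⟩
    · exact (isRepresentable_empty (by omega)).of_agreeUpToScaling h
    · obtain ⟨i, rfl⟩ := (isDelsarteClique_iff (by omega)).1 hU
      obtain ⟨k, rfl⟩ : ∃ k, m = k + 1 + 1 := ⟨m - 2, by omega⟩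
      exact (isRepresentable_star_of_lt_ten (by omega) (by omega) i).of_agreeUpToScaling h
  · rintro U hU a b hab p q hpq ⟨φ, h⟩
    obtain rfl := h.eq_two_mul (by omega) (by omega)
    have ha : 0 < a := by linarith
    rcases h.eq_star_or_const (by omega) (by omega) ha (by omega) with
      ⟨hU' | hU', hp⟩ | ⟨i, hU' | hU', hp, -⟩
    · obtain ⟨rfl, rfl⟩ : p = m - 1 ∧ q = 0 := by omega
      exact ⟨Or.inl hU', agreeUpToScaling_one_two ha _ _⟩
    · exact absurd hU' (ne_univ_of_two_mul_card_le (by omega) hU)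
    · have hp' := hp (by omega)
      obtain ⟨rfl, rfl⟩ : p = m - 1 ∧ q = 0 := by omega
      exact ⟨Or.inr ((isDelsarteClique_iff (by omega)).2 ⟨i, hU'⟩),
        agreeUpToScaling_one_two ha _ _⟩
    · exact absurd hU' (ne_compl_pointStar_of_two_mul_card_le (by omega) hU i)

lemma classification_eight :
    IsMinDimensionality (johnsonGraph 8) 7 ∧
      AttainedExactlyBy (johnsonGraph 8) 7 (fun _ a b p q =>
        AgreeUpToScaling 1 2 7 0 a b p q) := by
  refine isMinDimensionality_and_attainedExactlyBy (fun U a b p q h => h.neg)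
    (fun U a b p q h => h.add_eq)
    ⟨∅, 1, 2, 7, 0, by norm_num, AgreeUpToScaling.refl _ _ _ _⟩
    (fun U a b p q h => (isRepresentable_eight U).of_agreeUpToScaling h) ?_
  rintro U hU a b hab p q hpq ⟨φ, h⟩
  obtain rfl := h.eq_two_mul (by omega) (by omega)
  have ha : 0 < a := by linarith
  have hp := h.seven_le ha
  obtain ⟨rfl, rfl⟩ : p = 7 ∧ q = 0 := by omega
  exact agreeUpToScaling_one_two ha _ _

lemma classification_ten :
    IsMinDimensionality (johnsonGraph 10) 8 ∧
      AttainedExactlyBy (johnsonGraph 10) 8 (fun U a b p q =>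
        IsDelsarteClique (johnsonGraph 10) U ∧ AgreeUpToScaling 1 2 8 0 a b p q) := by
  refine isMinDimensionality_and_attainedExactlyBy ?_ ?_
    ⟨pointStar 0, 1, 2, 8, 0, by norm_num, (isDelsarteClique_iff (by omega)).2 ⟨0, rfl⟩,
      AgreeUpToScaling.refl _ _ _ _⟩ ?_ ?_
  · exact fun U a b p q h => h.imp_right AgreeUpToScaling.neg
  · rintro U a b p q ⟨-, h⟩
    exact h.add_eq
  · rintro U a b p q ⟨hU, h⟩
    obtain ⟨i, rfl⟩ := (isDelsarteClique_iff (by omega)).1 hU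
    exact (isRepresentable_star_ten i).of_agreeUpToScaling h
  · rintro U hU a b hab p q hpq ⟨φ, h⟩
    obtain rfl := h.eq_two_mul (by omega) (by omega)
    have ha : 0 < a := by linarith
    rcases h.eq_star_or_const (by omega) (by omega) ha (by omega) with
      ⟨-, hp⟩ | ⟨i, hU' | hU', -, hp, -⟩
    · omega
    · obtain ⟨rfl, rfl⟩ : p = 8 ∧ q = 0 := by omega
      exact ⟨(isDelsarteClique_iff (by omega)).2 ⟨i, hU'⟩, agreeUpToScaling_one_two ha _ _⟩
    · exact absurd hU' (ne_compl_pointStar_of_two_mul_card_le (by omega) hU i)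

lemma classification_of_eleven_le {m : ℕ} (hm : 11 ≤ m) :
    IsMinDimensionality (johnsonGraph m) (m - 1) ∧
      AttainedExactlyBy (johnsonGraph m) (m - 1) (fun U a b p q =>
        (U = ∅ ∧ AgreeUpToScaling 1 2 (m - 1) 0 a b p q) ∨
        (IsDelsarteClique (johnsonGraph m) U ∧
          AgreeUpToScaling 1 2 (m - 2) 1 a b p q)) := by
  refine isMinDimensionality_and_attainedExactlyBy ?_ ?_
    ⟨∅, 1, 2, m - 1, 0, by norm_num, Or.inl ⟨rfl, AgreeUpToScaling.refl _ _ _ _⟩⟩ ?_ ?_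
  · exact fun U a b p q h => h.imp (And.imp_right AgreeUpToScaling.neg)
      (And.imp_right AgreeUpToScaling.neg)
  · rintro U a b p q (⟨-, h⟩ | ⟨-, h⟩)
    · exact h.add_eq
    · have := h.add_eq
      omega
  · rintro U a b p q (⟨rfl, h⟩ | ⟨hU, h⟩)
    · exact (isRepresentable_empty (by omega)).of_agreeUpToScaling h
    · obtain ⟨i, rfl⟩ := (isDelsarteClique_iff (by omega)).1 hU
      obtain ⟨k, rfl⟩ : ∃ k, m = k + 1 + 1 := ⟨m - 2, by omega⟩
      exact (isRepresentable_star_of_ten_lt (by omega) i).of_agreeUpToScaling h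
  · rintro U hU a b hab p q hpq ⟨φ, h⟩
    obtain rfl := h.eq_two_mul (by omega) (by omega)
    have ha : 0 < a := by linarith
    rcases h.eq_star_or_const (by omega) (by omega) ha (by omega) with
      ⟨hU' | hU', hp⟩ | ⟨i, hU' | hU', -, hp, hq⟩
    · obtain ⟨rfl, rfl⟩ : p = m - 1 ∧ q = 0 := by omega
      exact Or.inl ⟨hU', agreeUpToScaling_one_two ha _ _⟩
    · exact absurd hU' (ne_univ_of_two_mul_card_le (by omega) hU)
    · have hq' := hq hm
      obtain ⟨rfl, rfl⟩ : p = m - 2 ∧ q = 1 := by omega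
      exact Or.inr ⟨(isDelsarteClique_iff (by omega)).2 ⟨i, hU'⟩,
        agreeUpToScaling_one_two ha _ _⟩
    · exact absurd hU' (ne_compl_pointStar_of_two_mul_card_le (by omega) hU i)

theorem theorem4p2 (m : ℕ) (hm : 4 ≤ m) :
    (m = 4 →
      IsMinDimensionality (johnsonGraph m) 2 ∧
      AttainedExactlyBy (johnsonGraph m) 2 (fun U a b p q =>
        (U = ∅ ∧ AgreeUpToScaling 1 0 2 0 a b p q) ∨
        (IsNonadjacentPair (johnsonGraph m) U ∧ AgreeUpToScaling 1 0 1 1 a b p q)) ∧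
      (∀ c : ℝ, 0 < c → ∀ φ : JohnsonVertex m → PseudoEuclidean 2 0,
        IsRepresentation (seidelSwitch (johnsonGraph m) ∅) c 0 φ →
          IsRegularTriangle (Set.range φ))) ∧
    (m = 5 →
      IsMinDimensionality (johnsonGraph m) 4 ∧
      AttainedExactlyBy (johnsonGraph m) 4 (fun U a b p q =>
        ((U = ∅ ∨ IsDelsarteClique (johnsonGraph m) U) ∧ AgreeUpToScaling 1 2 4 0 a b p q) ∨
        (InducesFiveCycle (johnsonGraph m) U ∧ AgreeUpToScaling 2 1 4 0 a b p q))) ∧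
    (m = 6 ∨ m = 7 ∨ m = 9 →
      IsMinDimensionality (johnsonGraph m) (m - 1) ∧
      AttainedExactlyBy (johnsonGraph m) (m - 1) (fun U a b p q =>
        (U = ∅ ∨ IsDelsarteClique (johnsonGraph m) U) ∧
          AgreeUpToScaling 1 2 (m - 1) 0 a b p q)) ∧
    (m = 8 →
      IsMinDimensionality (johnsonGraph m) 7 ∧
      AttainedExactlyBy (johnsonGraph m) 7 (fun _ a b p q =>
        AgreeUpToScaling 1 2 7 0 a b p q)) ∧
    (m = 10 →
      IsMinDimensionality (johnsonGraph m) 8 ∧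
      AttainedExactlyBy (johnsonGraph m) 8 (fun U a b p q =>
        IsDelsarteClique (johnsonGraph m) U ∧ AgreeUpToScaling 1 2 8 0 a b p q)) ∧
    (11 ≤ m →
      IsMinDimensionality (johnsonGraph m) (m - 1) ∧
      AttainedExactlyBy (johnsonGraph m) (m - 1) (fun U a b p q =>
        (U = ∅ ∧ AgreeUpToScaling 1 2 (m - 1) 0 a b p q) ∨
        (IsDelsarteClique (johnsonGraph m) U ∧
          AgreeUpToScaling 1 2 (m - 2) 1 a b p q))) := by
  refine ⟨?_, ?_, classification_six_seven_nine, ?_, ?_, classification_of_eleven_le⟩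
  · rintro rfl
    exact ⟨classification_four.1, classification_four.2,
      fun c hc φ h => isRegularTriangle_range hc h⟩
  · rintro rfl
    exact classification_five
  · rintro rfl
    exact classification_eight
  · rintro rfl
    exact classification_ten
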